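/- **Theorem.** For every $\delta$ there is a constant $D=D(\delta)$, depending only on $\delta$, with the following property. Let $(G,\mathcal P)$ be a relatively hyperbolic pair ($\mathcal P$ a finite, possibly empty, collection of subgroups of $G$), and let $(H,\mathcal D)$ be a fully quasiconvex subgroup: $(H,\mathcal D)$ is relatively quasiconvex in $(G,\mathcal P)$, and $[P:gDg^{-1}]<\infty$ whenever $gDg^{-1}\cap P$ is infinite ($g\in G$, $D\in\mathcal D$, $P\in\mathcal P$). If $\mathcal P=\emptyset$, let $\Gamma$ be any connected graph on which $G$ acts freely and cocompactly and $\tilde *$ any vertex of $\Gamma$; otherwise let $\Gamma$ be the $1$-skeleton of a cusped space $X(G,\mathcal P,S)$, with every edge replaced by two edges (one for each orientation) so that $G$ acts freely, and let $\tilde *=1\in G\subset\Gamma$. Suppose that $\Gamma$ is $\delta$-hyperbolic. Let $R\ge 0$ with $R>D$, and let $\tilde Z\subset\Gamma$ be an $R$-hull for $H$, that is, a connected $H$-invariant subgraph such that 1. $\tilde *\in\tilde Z$; 2. for every geodesic $\gamma$ of $\Gamma$ with both endpoints in the limit set of $H$, the $R$-neighbourhood of $\gamma$ is contained in $\tilde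 Z$; 3. if $\mathcal P\neq\emptyset$, every horoball of $\Gamma$ whose stabilizer in $H$ is infinite contains a nested horoball that is contained in $\tilde Z$; 4. the action of $(H,\mathcal D)$ on $\tilde Z$ is weakly geometrically finite: $\tilde Z$ is Gromov hyperbolic with compact metrizable boundary $M=\partial\tilde Z$; with $M'$ denoting $M$ minus its isolated points with finite stabilizer, the infinite members of $\mathcal D$ are the peripheral subgroups of a geometrically finite convergence action of $H$ on $M'$ (every point of $M'$ is a conical limit point or a bounded parabolic point, each infinite $D\in\mathcal D$ is the stabilizer of a bounded parabolic point, and the stabilizer of each bounded parabolic point is conjugate to exactly one infinite $D\in\mathcal D$); each finite $D\in\mathcal D$ is the stabilizer of a point of $M\setminus M'$; and the stabilizer of each point of $M\setminus M'$ is conjugate to exactly one finite $D\in\mathcal D$. (Boundaries with fewer than three points are allowed.) Let $Z=\tilde Z/H$, $Y=\Gamma/G$, let $i\colon Z\to Y$ be the induced immersion, $*_H\in Z$ the image of $\tilde *$, and $s\colon\pi_1(Z,*_H)\to H$ the canonical surjection given by lifting loops. For each vertex $v$ of $Z$ let $\sigma_v$ be an edge path from $*_H$ to $v$ (for example the path in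 a fixed maximal tree). For $n>0$ let $$S_n=\{(z_1,\dots,z_n)\in Z^n : i(z_1)=\dots=i(z_n),\ z_j\ne z_k \text{ for } j\neq k\},$$ with its projections $\varpi_1,\dots,\varpi_n$ to $Z$. For a component $C$ of $S_n$ with base vertex $p=(p_1,\dots,p_n)$, let $\tau_{C,j}\colon\pi_1(C,p)\to H$ be $[\gamma]\mapsto s([\sigma_{p_j}\cdot(\varpi_j\circ\gamma)\cdot\bar\sigma_{p_j}])$. The *multiplicity* of $Z\to Y$ is the largest $n>0$ such that $S_n$ has a component $C$ for which all of the groups $\tau_{C,1}(\pi_1(C)),\dots,\tau_{C,n}(\pi_1(C))$ are infinite. The *height* of $H$ in $G$ is the largest $n>0$ such that there are $g_1,\dots,g_n\in G$ with pairwise distinct cosets $g_jH$ and $\bigcap_j g_jHg_j^{-1}$ infinite. (Each is $0$ if there is no such $n$, and $\infty$ if there is no largest one.) Then the height of $H$ in $G$ is equal to the multiplicity of $Z\to Y$. -/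

import Mathlib

universe u v

/-- A graph, possibly with loops and multiple edges. `E` is the set of oriented edges: each geometric
edge is a pair `{e, rev e}`, and `src e` is the origin of the oriented edge `e`. -/
structure SGraph where
  V : Type u
  E : Type u
  src : E → V
  rev : E → E
  rev_rev : ∀ e, rev (rev e) = e
  rev_ne : ∀ e, rev e ≠ e

namespace SGraph

/-- The terminus of an oriented edge. -/
def tgt (X : SGraph.{u}) (e : X.E) : X.V := X.src (X.rev e)

/-- `X.IsPath a l b`: the list `l` of oriented edges is an edge path from `a` to `b`. -/
def IsPath (X : SGraph.{u}) : X.V → List X.E → X.V → Prop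
  | a, [], b => a = b
  | a, e :: l, b => X.src e = a ∧ X.IsPath (X.tgt e) l b

/-- A connected (non-empty) graph. -/
def Connected (X : SGraph.{u}) : Prop :=
  Nonempty X.V ∧ ∀ a b : X.V, ∃ l, X.IsPath a l b

/-- The reverse of an edge path. -/
def revPath (X : SGraph.{u}) (l : List X.E) : List X.E := (l.map X.rev).reverse

theorem isPath_append (X : SGraph.{u}) (l l' : List X.E) (a c : X.V) :
    X.IsPath a (l ++ l') c ↔ ∃ b, X.IsPath a l b ∧ X.IsPath b l' c := by
  induction l generalizing a with
  | nil => simp [IsPath]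
  | cons e l ih => simp [IsPath, ih, and_assoc]

theorem isPath_revPath (X : SGraph.{u}) (l : List X.E) (a b : X.V) (h : X.IsPath a l b) :
    X.IsPath b (X.revPath l) a := by
  induction l generalizing a with
  | nil => simp only [IsPath] at h; simp [revPath, IsPath, h]
  | cons e l ih =>
    obtain ⟨h1, h2⟩ := h
    have : X.revPath (e :: l) = X.revPath l ++ [X.rev e] := by simp [revPath]
    rw [this, isPath_append]
    exact ⟨_, ih _ h2, rfl, by simp [IsPath, tgt, X.rev_rev, h1]⟩

theorem revPath_revPath (X : SGraph.{u}) (l : List X.E) : X.revPath (X.revPath l) = l := by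
  simp [revPath, X.rev_rev, Function.comp_def]

/-- Edge loops based at `p`. -/
def Loop (X : SGraph.{u}) (p : X.V) : Type u := {l : List X.E // X.IsPath p l p}

/-- Deletion of a backtrack `e, rev e` from an edge loop. -/
def Step (X : SGraph.{u}) (p : X.V) (l l' : X.Loop p) : Prop :=
  ∃ a c e, l.1 = a ++ e :: X.rev e :: c ∧ l'.1 = a ++ c

/-- The (edge-path) fundamental group of a graph at `p`: edge loops at `p` modulo insertion and
deletion of backtracks, with concatenation. It is the fundamental group of the connected component
of `p` in the geometric realization. -/
def FundGroup (X : SGraph.{u}) (p : X.V) : Type u := Quot (X.Step p)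

namespace FundGroup
variable {X : SGraph.{u}} {p : X.V}

def mk (l : List X.E) (h : X.IsPath p l p) : X.FundGroup p := Quot.mk _ ⟨l, h⟩

theorem mk_congr {l l' : List X.E} (e : l = l') (h : X.IsPath p l p) :
    mk l h = mk l' (e ▸ h) := by subst e; rfl

theorem mk_cancel (l a c : List X.E) (h : X.IsPath p (a ++ l ++ X.revPath l ++ c) p)
    (h' : X.IsPath p (a ++ c) p) : mk _ h = mk _ h' := by
  induction l generalizing a c with
  | nil => exact mk_congr (by simp [revPath]) h
  | cons e l ih =>
    have e1 : a ++ (e :: l) ++ X.revPath (e :: l) ++ c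
        = (a ++ [e]) ++ l ++ X.revPath l ++ (X.rev e :: c) := by simp [revPath]
    have hm : X.IsPath p ((a ++ [e]) ++ (X.rev e :: c)) p := by
      have h2 := e1 ▸ h
      simp only [isPath_append] at h2 h' ⊢
      obtain ⟨b1, ⟨b2, ⟨b3, ⟨b, ha, hb⟩, _⟩, _⟩, hc⟩ := h2
      obtain ⟨b', ha', hc'⟩ := h'
      refine ⟨_, ⟨b, ha, hb⟩, ?_⟩
      simp only [IsPath] at hb hc ⊢
      obtain ⟨rfl, rfl⟩ := hb
      exact ⟨rfl, hc.2⟩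
    rw [mk_congr e1, ih _ _ _ hm]
    exact Quot.sound ⟨a, c, e, by simp, rfl⟩

def mul (x y : X.FundGroup p) : X.FundGroup p :=
  Quot.map₂ (fun l l' => ⟨l.1 ++ l'.1, (X.isPath_append _ _ _ _).2 ⟨p, l.2, l'.2⟩⟩)
    (by rintro l m m' ⟨a, c, e, h, h'⟩; exact ⟨l.1 ++ a, c, e, by simp [h], by simp [h']⟩)
    (by rintro l l' m ⟨a, c, e, h, h'⟩; exact ⟨a, c ++ m.1, e, by simp [h], by simp [h']⟩) x y

def inv (x : X.FundGroup p) : X.FundGroup p :=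
  Quot.map (fun l => ⟨X.revPath l.1, X.isPath_revPath _ _ _ l.2⟩)
    (by
      rintro l l' ⟨a, c, e, h, h'⟩
      exact ⟨X.revPath c, X.revPath a, e, by simp [h, revPath, X.rev_rev],
        by simp [h', revPath]⟩) x

instance : Group (X.FundGroup p) where
  mul := mul
  one := mk [] rfl
  inv := inv
  mul_assoc := by
    rintro ⟨x⟩ ⟨y⟩ ⟨z⟩
    exact mk_congr (List.append_assoc _ _ _) _
  one_mul := by rintro ⟨x⟩; rfl
  mul_one := by rintro ⟨x⟩; exact mk_congr (List.append_nil _) _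
  inv_mul_cancel := by
    rintro ⟨x⟩
    have h : X.IsPath p (X.revPath x.1 ++ x.1) p :=
      (X.isPath_append _ _ _ _).2 ⟨p, X.isPath_revPath _ _ _ x.2, x.2⟩
    have e : X.revPath x.1 ++ x.1 = [] ++ X.revPath x.1 ++ X.revPath (X.revPath x.1) ++ [] := by
      simp [revPath_revPath]
    have h0 : X.IsPath p ([] ++ []) p := rfl
    exact (mk_congr e h).trans (mk_cancel _ _ _ (e ▸ h) h0)

theorem mk_mul_mk (l l' : List X.E) (h : X.IsPath p l p) (h' : X.IsPath p l' p) :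
    mk l h * mk l' h' = mk (l ++ l') ((X.isPath_append _ _ _ _).2 ⟨p, h, h'⟩) := rfl

/-- The isomorphism `[γ] ↦ [σ γ σ⁻¹]` from loops at `p` to loops at `b`, for an edge path `σ` from
`b` to `p`. -/
def changeBase {b : X.V} (σ : List X.E) (hσ : X.IsPath b σ p) :
    X.FundGroup p →* X.FundGroup b :=
  MonoidHom.mk'
    (Quot.map (fun l => ⟨σ ++ l.1 ++ X.revPath σ, by
        simp only [isPath_append]
        exact ⟨p, ⟨p, hσ, l.2⟩, X.isPath_revPath _ _ _ hσ⟩⟩)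
      (by
        rintro l l' ⟨a, c, e, h, h'⟩
        exact ⟨σ ++ a, c ++ X.revPath σ, e, by simp [h], by simp [h']⟩))
    (by
      rintro ⟨x⟩ ⟨y⟩
      have h0 : X.IsPath b ((σ ++ x.1) ++ (y.1 ++ X.revPath σ)) b := by
        simp only [isPath_append]
        exact ⟨p, ⟨p, hσ, x.2⟩, p, y.2, X.isPath_revPath _ _ _ hσ⟩
      have h1 : X.IsPath b ((σ ++ x.1) ++ X.revPath σ ++ X.revPath (X.revPath σ)
          ++ (y.1 ++ X.revPath σ)) b := by
        simp only [isPath_append, revPath_revPath]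
        exact ⟨p, ⟨b, ⟨p, ⟨p, hσ, x.2⟩, X.isPath_revPath _ _ _ hσ⟩, hσ⟩, p, y.2,
          X.isPath_revPath _ _ _ hσ⟩
      have h2 := mk_cancel _ _ _ h1 h0
      have h3 : X.IsPath b (σ ++ (x.1 ++ y.1) ++ X.revPath σ) b := by
        simpa only [List.append_assoc] using h0
      have h4 : mk (σ ++ (x.1 ++ y.1) ++ X.revPath σ) h3 = mk _ h0 := mk_congr (by simp) h3
      exact (h4.trans h2.symm).trans (mk_congr (by simp [revPath_revPath]) h1))

end FundGroup

/-- Morphisms of graphs. -/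
structure Hom (X Y : SGraph.{u}) where
  onV : X.V → Y.V
  onE : X.E → Y.E
  src_onE : ∀ e, Y.src (onE e) = onV (X.src e)
  rev_onE : ∀ e, Y.rev (onE e) = onE (X.rev e)

theorem Hom.isPath_map {X Y : SGraph.{u}} (f : X.Hom Y) {a b : X.V} {l : List X.E}
    (h : X.IsPath a l b) : Y.IsPath (f.onV a) (l.map f.onE) (f.onV b) := by
  induction l generalizing a with
  | nil => simp only [IsPath] at h; simp [IsPath, h]
  | cons e l ih =>
    refine ⟨(f.src_onE e).trans (by rw [h.1]), ?_⟩
    have := ih h.2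
    rwa [tgt, ← f.src_onE, ← f.rev_onE] at this

/-- The homomorphism on fundamental groups induced by a morphism of graphs. -/
def Hom.fundMap {X Y : SGraph.{u}} (f : X.Hom Y) (p : X.V) :
    X.FundGroup p →* Y.FundGroup (f.onV p) :=
  MonoidHom.mk'
    (Quot.map (fun l => ⟨l.1.map f.onE, f.isPath_map l.2⟩)
      (by
        rintro l l' ⟨a, c, e, h, h'⟩
        exact ⟨a.map f.onE, c.map f.onE, f.onE e, by simp [h, f.rev_onE], by simp [h']⟩))
    (by rintro ⟨x⟩ ⟨y⟩; exact FundGroup.mk_congr (List.map_append) _)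


/-- An action of `K` by graph automorphisms on `X` that is free on the geometric realization: vertex
stabilizers are trivial and no element maps an oriented edge to its reverse. -/
class FreeAction (K : Type v) [Group K] (X : SGraph.{u}) where
  actV : MulAction K X.V
  actE : MulAction K X.E
  src_smul : ∀ (k : K) (e : X.E), X.src (k • e) = k • X.src e
  rev_smul : ∀ (k : K) (e : X.E), X.rev (k • e) = k • X.rev e
  free : ∀ (k : K) (x : X.V), k • x = x → k = 1
  no_inversion : ∀ (k : K) (e : X.E), k • e ≠ X.rev e

attribute [reducible, instance] FreeAction.actV FreeAction.actE

/-- The restriction of a free action to a subgroup. -/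
instance restrictAction {G : Type v} [Group G] (X : SGraph.{u}) [FreeAction G X]
    (H : Subgroup G) : FreeAction H X where
  actV := inferInstance
  actE := inferInstance
  src_smul k e := FreeAction.src_smul (k : G) e
  rev_smul k e := FreeAction.rev_smul (k : G) e
  free k x h := Subtype.ext (FreeAction.free (k : G) x h)
  no_inversion k e := FreeAction.no_inversion (k : G) e

section Quotient

variable (K : Type v) [Group K] (X : SGraph.{u}) [FreeAction K X]

theorem FreeAction.edge_eq {K : Type v} [Group K] {X : SGraph.{u}} [FreeAction K X]
    {k : K} {e e' : X.E} (h : k • e = e') (hs : X.src e = X.src e') : e = e' := by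
  have h1 : k • X.src e = X.src e := by rw [← FreeAction.src_smul, h, hs]
  have h2 := FreeAction.free k _ h1
  rw [← h, h2, one_smul]

/-- The quotient graph `X / K`. -/
def quotient : SGraph.{u} where
  V := MulAction.orbitRel.Quotient K X.V
  E := MulAction.orbitRel.Quotient K X.E
  src := Quotient.map' X.src (by
    rintro a b ⟨k, rfl⟩
    exact ⟨k, (FreeAction.src_smul k b).symm⟩)
  rev := Quotient.map' X.rev (by
    rintro a b ⟨k, rfl⟩
    exact ⟨k, (FreeAction.rev_smul k b).symm⟩)
  rev_rev := by
    rintro ⟨e⟩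
    exact congrArg (Quotient.mk'') (X.rev_rev e)
  rev_ne := by
    rintro ⟨e⟩ h
    obtain ⟨k, hk⟩ := Quotient.exact h
    exact FreeAction.no_inversion k e hk

/-- The projection `X → X / K` (a covering). -/
def proj : X.Hom (X.quotient K) where
  onV := Quotient.mk''
  onE := Quotient.mk''
  src_onE _ := rfl
  rev_onE _ := rfl

theorem proj_onE_eq {e e' : X.E} :
    (X.proj K).onE e = (X.proj K).onE e' ↔ ∃ k : K, k • e' = e :=
  ⟨fun h => Quotient.exact h, fun h => Quotient.sound h⟩

theorem proj_onV_eq {a b : X.V} :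
    (X.proj K).onV a = (X.proj K).onV b ↔ ∃ k : K, k • b = a :=
  ⟨fun h => Quotient.exact h, fun h => Quotient.sound h⟩

theorem exists_lift (l : List (X.quotient K).E) (a : X.V) (z : (X.quotient K).V)
    (h : (X.quotient K).IsPath ((X.proj K).onV a) l z) :
    ∃ m b, X.IsPath a m b ∧ m.map (X.proj K).onE = l ∧ (X.proj K).onV b = z := by
  induction l generalizing a with
  | nil => exact ⟨[], a, rfl, rfl, h⟩
  | cons ε l ih =>
    obtain ⟨h1, h2⟩ := h
    induction ε using Quotient.inductionOn' with
    | h e =>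
      obtain ⟨k, hk⟩ := (X.proj_onV_eq K).1 h1.symm
      replace hk : X.src (k • e) = a := (FreeAction.src_smul k e).trans hk
      have h3 : (X.proj K).onE (k • e) = (X.proj K).onE e := (X.proj_onE_eq K).2 ⟨k, rfl⟩
      have h4 : (X.proj K).onV (X.tgt (k • e)) = (X.quotient K).tgt ((X.proj K).onE e) := by
        rw [← h3]; rfl
      obtain ⟨m, b, hm, hml, hb⟩ := ih (X.tgt (k • e)) (by rw [h4]; exact h2)
      exact ⟨(k • e) :: m, b, ⟨hk, hm⟩, by simp only [List.map_cons, hml, h3]; rfl, hb⟩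

theorem lift_unique {m m' : List X.E} {a b b' : X.V} (h : X.IsPath a m b)
    (h' : X.IsPath a m' b') (e : m.map (X.proj K).onE = m'.map (X.proj K).onE) : b = b' := by
  induction m generalizing a m' with
  | nil =>
    cases m' with
    | nil => exact h.symm.trans h'
    | cons _ _ => simp at e
  | cons x m ih =>
    cases m' with
    | nil => simp at e
    | cons x' m' =>
      simp only [List.map_cons, List.cons.injEq] at e
      obtain ⟨k, hk⟩ := (X.proj_onE_eq K).1 e.1
      have hx : x' = x := FreeAction.edge_eq hk (h'.1.trans h.1.symm)
      subst hx
      exact ih h.2 h'.2 e.2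

theorem smul_isPath {k : K} {a b : X.V} {m : List X.E} (h : X.IsPath a m b) :
    X.IsPath (k • a) (m.map (k • ·)) (k • b) := by
  induction m generalizing a with
  | nil => simp only [IsPath] at h; simp [IsPath, h]
  | cons e m ih =>
    refine ⟨(FreeAction.src_smul k e).trans (by rw [h.1]), ?_⟩
    have := ih h.2
    rwa [tgt, ← FreeAction.src_smul, ← FreeAction.rev_smul] at this

theorem proj_smul (k : K) (m : List X.E) :
    (m.map (k • ·)).map (X.proj K).onE = m.map (X.proj K).onE := by
  rw [List.map_map]
  exact List.map_congr_left fun e _ => (X.proj_onE_eq K).2 ⟨k, rfl⟩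

/-- The lift starting at `b` of the edge path `l` of `X / K` ends at `k • b`. -/
def LiftsTo (b : X.V) (l : List (X.quotient K).E) (k : K) : Prop :=
  ∃ m, X.IsPath b m (k • b) ∧ m.map (X.proj K).onE = l

variable {K X}

theorem exists_liftsTo {b : X.V} (l : (X.quotient K).Loop ((X.proj K).onV b)) :
    ∃ k, LiftsTo K X b l.1 k := by
  obtain ⟨m, c, hm, hl, hc⟩ := X.exists_lift K l.1 b _ l.2
  obtain ⟨k, rfl⟩ := (X.proj_onV_eq K).1 hc
  exact ⟨k, m, hm, hl⟩

theorem LiftsTo.unique {b : X.V} {l : List (X.quotient K).E} {k k' : K}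
    (h : LiftsTo K X b l k) (h' : LiftsTo K X b l k') : k = k' := by
  obtain ⟨m, hm, hl⟩ := h
  obtain ⟨m', hm', hl'⟩ := h'
  have := X.lift_unique K hm hm' (hl.trans hl'.symm)
  have h2 : (k'⁻¹ * k) • b = b := by rw [mul_smul, this, inv_smul_smul]
  have h3 := FreeAction.free _ _ h2
  exact (inv_mul_eq_one.1 h3).symm

theorem LiftsTo.mul {b : X.V} {l l' : List (X.quotient K).E} {k k' : K}
    (h : LiftsTo K X b l k) (h' : LiftsTo K X b l' k') : LiftsTo K X b (l ++ l') (k * k') := by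
  obtain ⟨m, hm, rfl⟩ := h
  obtain ⟨m', hm', rfl⟩ := h'
  refine ⟨m ++ m'.map (k • ·), (X.isPath_append _ _ _ _).2 ⟨_, hm, ?_⟩, ?_⟩
  · rw [mul_smul]; exact X.smul_isPath K hm'
  · rw [List.map_append, proj_smul]

theorem LiftsTo.step {b : X.V} {l l' : (X.quotient K).Loop ((X.proj K).onV b)} {k : K}
    (hs : (X.quotient K).Step _ l l') (h : LiftsTo K X b l.1 k) : LiftsTo K X b l'.1 k := by
  obtain ⟨a, c, e, h1, h2⟩ := hs
  obtain ⟨m, hm, hl⟩ := h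
  rw [h1, List.map_eq_append_iff] at hl
  obtain ⟨m1, m2, rfl, ha, h3⟩ := hl
  rw [List.map_eq_cons_iff] at h3
  obtain ⟨x, m3, rfl, hx, h4⟩ := h3
  rw [List.map_eq_cons_iff] at h4
  obtain ⟨y, m4, rfl, hy, h5⟩ := h4
  obtain ⟨v, hv, hx1, hy1, hm4⟩ := (X.isPath_append _ _ _ _).1 hm
  have hyx : (X.proj K).onE (X.rev x) = (X.proj K).onE y := by
    rw [hy, ← hx]; rfl
  obtain ⟨g, hg⟩ := (X.proj_onE_eq K).1 hyx
  have : y = X.rev x := FreeAction.edge_eq hg hy1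
  subst this
  rw [tgt, X.rev_rev, hx1] at hm4
  exact ⟨m1 ++ m4, (X.isPath_append _ _ _ _).2 ⟨v, hv, hm4⟩, by
    rw [List.map_append, ha, h5, h2]⟩

/-- The element `k` such that the lift of `l` starting at `b` ends at `k • b`. -/
noncomputable def deckElt (b : X.V) (l : (X.quotient K).Loop ((X.proj K).onV b)) : K :=
  Classical.choose (exists_liftsTo l)

theorem deckElt_spec (b : X.V) (l : (X.quotient K).Loop ((X.proj K).onV b)) :
    LiftsTo K X b l.1 (deckElt b l) := Classical.choose_spec (exists_liftsTo l)

variable (K X)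

/-- The canonical homomorphism `s : π₁(X / K, [b]) → K` of the covering `X → X / K`: a loop `l` is
sent to the `k` such that the lift of `l` starting at `b` ends at `k • b`.
It is onto when `X` is connected. -/
noncomputable def deckHom (b : X.V) : (X.quotient K).FundGroup ((X.proj K).onV b) →* K :=
  MonoidHom.mk'
    (Quot.lift (fun l => deckElt b l)
      (fun l l' h => ((deckElt_spec b l).step h).unique (deckElt_spec b l')))
    (by
      rintro ⟨x⟩ ⟨y⟩
      exact (deckElt_spec b _).unique ((deckElt_spec b x).mul (deckElt_spec b y)))

end Quotient

/-- A `K`-invariant subgraph of `X`. -/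
structure InvSubgraph (K : Type v) [Group K] (X : SGraph.{u}) [FreeAction K X] where
  verts : Set X.V
  edges : Set X.E
  src_mem : ∀ e ∈ edges, X.src e ∈ verts
  rev_mem : ∀ e ∈ edges, X.rev e ∈ edges
  smul_vert : ∀ (k : K), ∀ x ∈ verts, k • x ∈ verts
  smul_edge : ∀ (k : K), ∀ e ∈ edges, k • e ∈ edges

namespace InvSubgraph

variable {K : Type v} [Group K] {X : SGraph.{u}} [FreeAction K X] (Z : InvSubgraph K X)

def graph : SGraph.{u} where
  V := Z.verts
  E := Z.edges
  src e := ⟨X.src e, Z.src_mem _ e.2⟩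
  rev e := ⟨X.rev e, Z.rev_mem _ e.2⟩
  rev_rev e := Subtype.ext (X.rev_rev e)
  rev_ne e h := X.rev_ne e (congrArg Subtype.val h)

instance : FreeAction K Z.graph where
  actV :=
    { smul := fun k x => ⟨k • x.1, Z.smul_vert k _ x.2⟩
      one_smul := fun x => Subtype.ext (one_smul K x.1)
      mul_smul := fun k k' x => Subtype.ext (mul_smul k k' x.1) }
  actE :=
    { smul := fun k x => ⟨k • x.1, Z.smul_edge k _ x.2⟩
      one_smul := fun x => Subtype.ext (one_smul K x.1)
      mul_smul := fun k k' x => Subtype.ext (mul_smul k k' x.1) }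
  src_smul k e := Subtype.ext (FreeAction.src_smul k e.1)
  rev_smul k e := Subtype.ext (FreeAction.rev_smul k e.1)
  free k x h := FreeAction.free k x.1 (congrArg Subtype.val h)
  no_inversion k e h := FreeAction.no_inversion k e.1 (congrArg Subtype.val h)

end InvSubgraph

section Multiplicity

variable {G : Type v} [Group G] {H : Subgroup G} {Γ : SGraph.{u}} [FreeAction G Γ]
  (Z : InvSubgraph H Γ)

/-- For a subgroup `H` of `G` and an `H`-invariant subgraph `Z` of `Γ`, the map `Z / H → Γ / G`
induced by the inclusion of `Z` in `Γ`. -/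
def InvSubgraph.immersion : (Z.graph.quotient H).Hom (Γ.quotient G) where
  onV := Quotient.map' Subtype.val (by
    rintro a b ⟨k, rfl⟩
    exact ⟨(k : G), rfl⟩)
  onE := Quotient.map' Subtype.val (by
    rintro a b ⟨k, rfl⟩
    exact ⟨(k : G), rfl⟩)
  src_onE := by rintro ⟨e⟩; rfl
  rev_onE := by rintro ⟨e⟩; rfl

/-- The map `Z / H → Γ / G` is locally injective. -/
theorem InvSubgraph.immersion_inj {e e' : (Z.graph.quotient H).E}
    (h : Z.immersion.onE e = Z.immersion.onE e')
    (hs : (Z.graph.quotient H).src e = (Z.graph.quotient H).src e') : e = e' := by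
  induction e using Quotient.inductionOn' with
  | h e =>
  induction e' using Quotient.inductionOn' with
  | h e' =>
  obtain ⟨g, hg⟩ := (Γ.proj_onE_eq G).1 h
  obtain ⟨k, hk⟩ := (Z.graph.proj_onV_eq H).1 hs
  have hk' : (k : G) • Γ.src e'.1 = Γ.src e.1 := congrArg Subtype.val hk
  have h1 : g • Γ.src e'.1 = Γ.src e.1 := by rw [← FreeAction.src_smul, hg]
  have h2 : ((k : G)⁻¹ * g) • Γ.src e'.1 = Γ.src e'.1 := by
    rw [mul_smul, h1, ← hk', inv_smul_smul]
  have h3 : (k : G) = g := inv_mul_eq_one.1 (FreeAction.free _ _ h2)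
  refine (Z.graph.proj_onE_eq H).2 ⟨k, Subtype.ext ?_⟩
  rw [← hg, ← h3]
  rfl

/-- The space `S_n` of `n`-tuples of pairwise distinct points of `Z / H` with the same image in
`Γ / G`, where `n > 0`. As `Z / H → Γ / G` maps open edges homeomorphically to open edges and is
locally injective, this subspace of `(Z / H)ⁿ` is a graph: its vertices (edges) are the `n`-tuples of
pairwise distinct vertices (oriented edges) with the same image. -/
def InvSubgraph.pullback (n : ℕ) [NeZero n] : SGraph.{u} where
  V := {z : Fin n → (Z.graph.quotient H).V //
    (∀ i j, Z.immersion.onV (z i) = Z.immersion.onV (z j)) ∧ Function.Injective z}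
  E := {e : Fin n → (Z.graph.quotient H).E //
    (∀ i j, Z.immersion.onE (e i) = Z.immersion.onE (e j)) ∧ Function.Injective e}
  src e := ⟨fun i => (Z.graph.quotient H).src (e.1 i),
    fun i j => by rw [← Z.immersion.src_onE, ← Z.immersion.src_onE, e.2.1 i j],
    fun i j h => e.2.2 (Z.immersion_inj (e.2.1 i j) h)⟩
  rev e := ⟨fun i => (Z.graph.quotient H).rev (e.1 i),
    fun i j => by rw [← Z.immersion.rev_onE, ← Z.immersion.rev_onE, e.2.1 i j],
    fun i j h => e.2.2 (by
      have := congrArg (Z.graph.quotient H).rev h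
      simpa only [(Z.graph.quotient H).rev_rev] using this)⟩
  rev_rev e := Subtype.ext (funext fun i => (Z.graph.quotient H).rev_rev _)
  rev_ne e h := (Z.graph.quotient H).rev_ne (e.1 0) (congrFun (congrArg Subtype.val h) 0)

/-- The `i`-th projection `S_n → Z / H`. -/
def InvSubgraph.coord (n : ℕ) [NeZero n] (i : Fin n) : (Z.pullback n).Hom (Z.graph.quotient H) where
  onV z := z.1 i
  onE e := e.1 i
  src_onE _ := rfl
  rev_onE _ := rfl


/-- The homomorphism `τ_{C,i} : π₁(C, p) → H`, where `C` is the component of `p` in `S_n`: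
`[γ] ↦ s [σ_{p_i} γ_i σ_{p_i}⁻¹]` with `γ_i` the `i`-th coordinate of `γ`. Here `σ z` is a chosen edge
path in `Z / H` from the base point to the vertex `z`, for instance the path in a maximal tree. -/
noncomputable def InvSubgraph.tau (b : Z.graph.V)
    (σ : ∀ z : (Z.graph.quotient H).V,
      {l // (Z.graph.quotient H).IsPath ((Z.graph.proj H).onV b) l z})
    (n : ℕ) [NeZero n] (p : (Z.pullback n).V) (i : Fin n) : (Z.pullback n).FundGroup p →* H :=
  (Z.graph.deckHom H b).comp
    ((FundGroup.changeBase (σ (p.1 i)).1 (σ (p.1 i)).2).comp ((Z.coord n i).fundMap p))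

/-- The multiplicity of `Z / H → Γ / G`: the largest `n > 0` such that `S_n` has a component `C` (the
component of a vertex `p`) for which all `n` groups `τ_{C,i} (π₁(C, p))` are infinite;
`0` if there is no such `n`, and `⊤` if they are unbounded. -/
noncomputable def InvSubgraph.multiplicity (b : Z.graph.V)
    (σ : ∀ z : (Z.graph.quotient H).V,
      {l // (Z.graph.quotient H).IsPath ((Z.graph.proj H).onV b) l z}) : ℕ∞ :=
  sSup {N | ∃ (n : ℕ) (_ : NeZero n), N = n ∧
    ∃ p : (Z.pullback n).V, ∀ i, ((Z.tau b σ n p i).range : Set H).Infinite}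

end Multiplicity

end SGraph

/-- The height of `H` in `G`: the largest `n > 0` such that there are `g₁, …, g_n` with pairwise
distinct cosets `g_i H` for which the intersection of the conjugates `g_i H g_i⁻¹` is infinite;
`0` if there is no such `n` (that is, if `H` is finite), and `⊤` if they are unbounded. -/
noncomputable def Subgroup.height {G : Type u} [Group G] (H : Subgroup G) : ℕ∞ :=
  sSup {N | ∃ n : ℕ, N = n ∧ 0 < n ∧ ∃ g : Fin n → G,
    Function.Injective (fun i => (g i : G ⧸ H)) ∧
    ((⨅ i, H.map (MulAut.conj (g i)).toMonoidHom : Subgroup G) : Set G).Infinite}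

namespace SimpleGraph

variable {V : Type u} (X : SimpleGraph V)

/-- A connected graph is `δ`-hyperbolic if its path metric satisfies the four-point inequality
`d(x,y) + d(z,w) ≤ max (d(x,z) + d(y,w)) (d(x,w) + d(y,z)) + 2δ`. -/
def IsGromovHyperbolic (δ : ℝ) : Prop :=
  X.Connected ∧ ∀ x y z w : V,
    (X.dist x y + X.dist z w : ℝ) ≤
      max (X.dist x z + X.dist y w : ℝ) (X.dist x w + X.dist y z) + 2 * δ

/-- Geodesics between points of `A` stay in the `C`-neighbourhood of `A`. -/
def IsQuasiconvexSet (C : ℕ) (A : Set V) : Prop :=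
  ∀ x ∈ A, ∀ y ∈ A, ∀ w, X.dist x w + X.dist w y = X.dist x y → ∃ a ∈ A, X.dist w a ≤ C

/-- The Gromov product of `x` and `y` based at `o`. -/
noncomputable def gromovProd (o x y : V) : ℝ := (X.dist o x + X.dist o y - X.dist x y : ℝ) / 2

/-- Geodesic rays (starting at vertices). -/
def GeodesicRay : Type u := {γ : ℕ → V // ∀ m k : ℕ, X.dist (γ m) (γ (m + k)) = k}

/-- Two rays are asymptotic if they stay at bounded distance. -/
def asymptotic : Setoid X.GeodesicRay where
  r γ γ' := ∃ C : ℕ, ∀ n, X.edist (γ.1 n) (γ'.1 n) ≤ C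
  iseqv :=
    { refl := fun γ => ⟨0, fun n => by simp⟩
      symm := fun ⟨C, h⟩ => ⟨C, fun n => by rw [edist_comm]; exact h n⟩
      trans := fun ⟨C, h⟩ ⟨C', h'⟩ => ⟨C + C', fun n => by
        push_cast
        exact X.edist_triangle.trans (add_le_add (h n) (h' n))⟩ }

/-- The Gromov boundary: geodesic rays up to bounded distance. -/
def GromovBoundary : Type u := Quotient X.asymptotic

/-- Rays carry the topology of pointwise convergence (the set of vertices being discrete), and the
boundary the quotient topology; this is the usual topology for locally finite hyperbolic graphs. -/
instance : TopologicalSpace X.GeodesicRay :=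
  TopologicalSpace.induced Subtype.val (@Pi.topologicalSpace ℕ (fun _ => V) (fun _ => ⊥))

instance : TopologicalSpace X.GromovBoundary :=
  inferInstanceAs (TopologicalSpace (Quotient X.asymptotic))

theorem Hom.edist_le {X} (f : X →g X) (a b : V) : X.edist (f a) (f b) ≤ X.edist a b := by
  by_cases h : X.edist a b = ⊤
  · rw [h]; exact le_top
  · obtain ⟨w, hw⟩ := X.exists_walk_of_edist_ne_top h
    rw [← hw, ← Walk.length_map f w]
    exact X.edist_le _

end SimpleGraph

namespace SGraph

/-- The simple graph underlying `X`; it has the same vertices and the same path metric. -/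
def simple (X : SGraph.{u}) : SimpleGraph X.V :=
  SimpleGraph.fromRel (fun a b => ∃ e, X.src e = a ∧ X.tgt e = b)

section
variable {K : Type v} [Group K] {X : SGraph.{u}} [FreeAction K X]

def smulHom (k : K) : X.simple →g X.simple where
  toFun x := k • x
  map_rel' := by
    rintro a b ⟨hne, h⟩
    refine ⟨fun h => hne (MulAction.injective k h), ?_⟩
    have key : ∀ {a b : X.V}, (∃ e, X.src e = a ∧ X.tgt e = b) →
        ∃ e, X.src e = k • a ∧ X.tgt e = k • b := by
      rintro _ _ ⟨e, rfl, rfl⟩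
      exact ⟨k • e, FreeAction.src_smul k e, by
        rw [tgt, FreeAction.rev_smul, FreeAction.src_smul]; rfl⟩
    exact h.imp key key

theorem edist_smul (k : K) (a b : X.V) : X.simple.edist (k • a) (k • b) = X.simple.edist a b := by
  refine le_antisymm ((smulHom k).edist_le a b) ?_
  have := (smulHom (X := X) k⁻¹).edist_le (k • a) (k • b)
  simpa [smulHom] using this

instance : MulAction K X.simple.GeodesicRay where
  smul k γ := ⟨fun n => k • γ.1 n, fun m l => by
    have := γ.2 m l
    rw [SimpleGraph.dist] at this ⊢
    rw [edist_smul, this]⟩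
  one_smul γ := Subtype.ext (funext fun n => one_smul K _)
  mul_smul k k' γ := Subtype.ext (funext fun n => mul_smul k k' _)

instance : MulAction K X.simple.GromovBoundary where
  smul k := Quotient.map (k • ·) (by
    rintro γ γ' ⟨C, h⟩
    exact ⟨C, fun n => (edist_smul k _ _).trans_le (h n)⟩)
  one_smul := by rintro ⟨γ⟩; exact congrArg _ (one_smul K γ)
  mul_smul k k' := by rintro ⟨γ⟩; exact congrArg _ (mul_smul k k' γ)

instance : ContinuousConstSMul K X.simple.GromovBoundary where
  continuous_const_smul k := by
    have hc : Continuous (fun γ : X.simple.GeodesicRay => k • γ) := by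
      refine continuous_induced_rng.2 ?_
      let _ : TopologicalSpace X.V := ⊥
      have _ : DiscreteTopology X.V := ⟨rfl⟩
      refine continuous_pi fun n => ?_
      exact (continuous_of_discreteTopology (f := fun x : X.V => k • x)).comp
        ((continuous_apply n).comp continuous_induced_dom)
    exact Continuous.quotient_lift (continuous_quotient_mk'.comp hc) _

end

end SGraph

section Dynamics

variable (K : Type v) [Group K] {M : Type u} [TopologicalSpace M] [MulAction K M]

variable (M) in
/-- A convergence action on a compact metrizable space `M`: an action by homeomorphisms that is
properly discontinuous on the space of unordered triples of distinct points. (Compact sets of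
unordered triples are the images of compact sets of ordered ones.) The space `M` may have fewer than
three points, so that elementary groups are included. -/
def IsConvergenceAction : Prop :=
  CompactSpace M ∧ TopologicalSpace.MetrizableSpace M ∧ ContinuousConstSMul K M ∧
  ∀ A : Set (Fin 3 → M), IsCompact A → (∀ t ∈ A, Function.Injective t) →
    {k : K | ∃ t ∈ A, ∃ σ : Equiv.Perm (Fin 3), (fun i => k • t (σ i)) ∈ A}.Finite

/-- Conical limit points. -/
def IsConicalLimitPoint (p : M) : Prop :=
  ∃ (k : ℕ → K) (a b : M), a ≠ b ∧
    Filter.Tendsto (fun n => k n • p) Filter.atTop (nhds b) ∧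
    ∀ x, x ≠ p → Filter.Tendsto (fun n => k n • x) Filter.atTop (nhds a)

/-- Parabolic points: the stabilizer is infinite, and `p` is not one of the exactly two fixed points
of an element of infinite order. -/
def IsParabolicPoint (p : M) : Prop :=
  (MulAction.stabilizer K p : Set K).Infinite ∧
    ¬ ∃ (k : K) (q : M), ¬ IsOfFinOrder k ∧ q ≠ p ∧ {x : M | k • x = x} = {p, q}

/-- Bounded parabolic points: the stabilizer acts cocompactly on `M ∖ {p}`. -/
def IsBoundedParabolicPoint (p : M) : Prop :=
  IsParabolicPoint K p ∧
    ∃ A : Set M, IsCompact A ∧ p ∉ A ∧ ∀ x, x ≠ p → ∃ k ∈ MulAction.stabilizer K p, k • x ∈ A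

/-- `A` is conjugate to `B`. -/
def IsConjOf (A B : Subgroup K) : Prop := ∃ k : K, A = B.map (MulAut.conj k).toMonoidHom

variable (M) in
/-- `(K, 𝓟)` acts geometrically finitely on `M`. -/
def ActsGeometricallyFinitely (𝓟 : Set (Subgroup K)) : Prop :=
  IsConvergenceAction K M ∧
  (∀ p : M, IsConicalLimitPoint K p ∨ IsBoundedParabolicPoint K p) ∧
  (∀ P ∈ 𝓟, ∃ p : M, IsBoundedParabolicPoint K p ∧ P = MulAction.stabilizer K p) ∧
  (∀ p : M, IsBoundedParabolicPoint K p →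
    ∃! P, P ∈ 𝓟 ∧ IsConjOf K (MulAction.stabilizer K p) P)

/-- Finite parabolic points: isolated points with finite stabilizer. -/
def IsFiniteParabolicPoint (p : M) : Prop :=
  IsOpen {p} ∧ (MulAction.stabilizer K p : Set K).Finite

variable (M) in
/-- `M` with its finite parabolic points removed. -/
def mainPart [ContinuousConstSMul K M] : SubMulAction K M where
  carrier := {p | ¬ IsFiniteParabolicPoint K p}
  smul_mem' := by
    intro k p hp hk
    refine hp ⟨?_, ?_⟩
    · have h1 := hk.1.preimage (continuous_const_smul k)
      have h2 : (fun x : M => k • x) ⁻¹' {k • p} = {p} := by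
        ext x; simp
      rwa [h2] at h1
    · have h1 := hk.2
      rw [MulAction.stabilizer_smul_eq_stabilizer_map_conj] at h1
      exact Set.Finite.of_finite_image h1 ((MulAut.conj k).injective.injOn)

variable (M) in
/-- `(K, 𝓟)` acts weakly geometrically finitely on `M`: off the finite parabolic points, the infinite
members of `𝓟` act as the peripheral subgroups of a geometrically finite action, and the finite
members of `𝓟` account for the stabilizers of the finite parabolic points. -/
def ActsWeaklyGeometricallyFinitely [ContinuousConstSMul K M] (𝓟 : Set (Subgroup K)) : Prop :=
  CompactSpace M ∧ TopologicalSpace.MetrizableSpace M ∧ 𝓟.Finite ∧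
  ActsGeometricallyFinitely K (mainPart K M) {P ∈ 𝓟 | (P : Set K).Infinite} ∧
  (∀ P ∈ 𝓟, (P : Set K).Finite →
    ∃ p : M, IsFiniteParabolicPoint K p ∧ P = MulAction.stabilizer K p) ∧
  (∀ p : M, IsFiniteParabolicPoint K p →
    ∃! P, (P ∈ 𝓟 ∧ (P : Set K).Finite) ∧ IsConjOf K (MulAction.stabilizer K p) P)

end Dynamics

/-- The action of `(K, 𝓟)` on a graph is WGF: the graph is hyperbolic and the action on its Gromov
boundary is weakly geometrically finite. -/
def SGraph.IsWGF (K : Type v) [Group K] (X : SGraph.{u}) [SGraph.FreeAction K X]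
    (𝓟 : Set (Subgroup K)) : Prop :=
  (∃ δ, X.simple.IsGromovHyperbolic δ) ∧
    ActsWeaklyGeometricallyFinitely K X.simple.GromovBoundary 𝓟

section Cusped

variable {G : Type u} [Group G]

/-- Vertices of the cusped space of `(G, 𝓟)`: the elements of `G`, and for every `P ∈ 𝓟`, every
`g ∈ G` (which lies in exactly one coset of `P`) and every depth `k + 1 > 0` a vertex `horo P g k`. -/
inductive CuspedVertex (𝓟 : Set (Subgroup G)) : Type u
  | base (g : G) : CuspedVertex 𝓟
  | horo (P : 𝓟) (g : G) (k : ℕ) : CuspedVertex 𝓟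

namespace CuspedVertex

variable {𝓟 : Set (Subgroup G)}

/-- The vertex over `g` at depth `k` in the combinatorial horoball of the coset `g P`. -/
def pt (P : 𝓟) (g : G) : ℕ → CuspedVertex 𝓟
  | 0 => base g
  | k + 1 => horo P g k

instance : MulAction G (CuspedVertex 𝓟) where
  smul x
    | base g => base (x * g)
    | horo P g k => horo P (x * g) k
  one_smul := by rintro (g | ⟨P, g, k⟩) <;> simp [HSMul.hSMul]
  mul_smul x y := by rintro (g | ⟨P, g, k⟩) <;> simp [HSMul.hSMul, mul_assoc]

end CuspedVertex

/-- Edges of the cusped space: those of the Cayley graph for `S`; vertical edges of the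
horoballs; and at each depth `k > 0` horizontal edges between distinct elements of a coset of `P` that
are at distance at most `2 ^ k` in the Cayley graph of `P` for the generating set `S ∩ P`. -/
inductive CuspedRel (𝓟 : Set (Subgroup G)) (S : Set G) :
    CuspedVertex 𝓟 → CuspedVertex 𝓟 → Prop
  | cayley (g s : G) (hs : s ∈ S) : CuspedRel 𝓟 S (.base g) (.base (g * s))
  | vertical (P : 𝓟) (g : G) (k : ℕ) : CuspedRel 𝓟 S (.pt P g k) (.pt P g (k + 1))
  | horizontal (P : 𝓟) (g g' : G) (k : ℕ)
      (h : (SimpleGraph.mulCayley (S ∩ P.1 : Set G)).edist g g' ≤ 2 ^ (k + 1)) :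
      CuspedRel 𝓟 S (.pt P g (k + 1)) (.pt P g' (k + 1))

/-- The 1-skeleton of the cusped space `X(G, 𝓟, S)`. -/
def cuspedGraph (𝓟 : Set (Subgroup G)) (S : Set G) : SimpleGraph (CuspedVertex 𝓟) :=
  SimpleGraph.fromRel (CuspedRel 𝓟 S)

/-- A finite generating set `S` of `G` such that `S ∩ P` generates `P` for each `P ∈ 𝓟`. -/
structure IsCompatibleGenSet (𝓟 : Set (Subgroup G)) (S : Set G) : Prop where
  finite : S.Finite
  closure_eq : Subgroup.closure S = ⊤
  closure_inter : ∀ P ∈ 𝓟, Subgroup.closure (S ∩ P) = P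

/-- `(G, 𝓟)` is relatively hyperbolic: `𝓟` is a finite collection and the cusped space is hyperbolic. -/
def IsRelativelyHyperbolic (𝓟 : Set (Subgroup G)) : Prop :=
  𝓟.Finite ∧ ∃ S, IsCompatibleGenSet 𝓟 S ∧ ∃ δ, (cuspedGraph 𝓟 S).IsGromovHyperbolic δ

/-- The map of cusped spaces extending the inclusion of `H` in `G`, when each `D ∈ 𝓓` is contained in
`c_D P_D c_D⁻¹`: the vertex over `h` at depth `k > 0` of the horoball of `h D` is sent to the vertex
over `h c_D` at depth `k` of the horoball of `h c_D P_D`. -/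
def cuspedMap {𝓟 : Set (Subgroup G)} {H : Subgroup G} {𝓓 : Set (Subgroup H)}
    (c : 𝓓 → G) (P : 𝓓 → 𝓟) : CuspedVertex 𝓓 → CuspedVertex 𝓟
  | .base h => .base h
  | .horo D h k => .horo (P D) (h * c D) k

/-- `(H, 𝓓)` is relatively quasiconvex in `(G, 𝓟)`: it is relatively hyperbolic, the members of `𝓓` are
contained in conjugates of members of `𝓟`, and the induced map of cusped spaces is Lipschitz
with quasiconvex image. -/
def IsRelativelyQuasiconvex (𝓟 : Set (Subgroup G)) (H : Subgroup G)
    (𝓓 : Set (Subgroup H)) : Prop :=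
  IsRelativelyHyperbolic 𝓓 ∧
  ∃ (S : Set G) (T : Set H), IsCompatibleGenSet 𝓟 S ∧ IsCompatibleGenSet 𝓓 T ∧
    ∃ (c : 𝓓 → G) (P : 𝓓 → 𝓟),
      (∀ D : 𝓓, D.1.map H.subtype ≤ (P D).1.map (MulAut.conj (c D)).toMonoidHom) ∧
      ∃ C : ℕ,
        (∀ x y, (cuspedGraph 𝓓 T).Adj x y →
          (cuspedGraph 𝓟 S).dist (cuspedMap c P x) (cuspedMap c P y) ≤ C) ∧
        (cuspedGraph 𝓟 S).IsQuasiconvexSet C (Set.range (cuspedMap c P))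

/-- `(H, 𝓓)` is fully quasiconvex in `(G, 𝓟)`: it is relatively quasiconvex, and `g D g⁻¹` has finite
index in `P` whenever `g D g⁻¹ ∩ P` is infinite, for `D ∈ 𝓓` and `P ∈ 𝓟`. -/
def IsFullyQuasiconvex (𝓟 : Set (Subgroup G)) (H : Subgroup G) (𝓓 : Set (Subgroup H)) : Prop :=
  IsRelativelyQuasiconvex 𝓟 H 𝓓 ∧
  ∀ D ∈ 𝓓, ∀ P ∈ 𝓟, ∀ g : G,
    (((D.map H.subtype).map (MulAut.conj g).toMonoidHom ⊓ P : Subgroup G) : Set G).Infinite →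
      ((D.map H.subtype).map (MulAut.conj g).toMonoidHom).relIndex P ≠ 0

theorem CuspedRel.smul {𝓟 : Set (Subgroup G)} {S : Set G} (x : G) {v w : CuspedVertex 𝓟}
    (h : CuspedRel 𝓟 S v w) : CuspedRel 𝓟 S (x • v) (x • w) := by
  have hpt : ∀ (P : 𝓟) (g : G) (k : ℕ), x • CuspedVertex.pt P g k = .pt P (x * g) k := by
    intro P g k; cases k <;> rfl
  cases h with
  | cayley g s hs =>
    have := CuspedRel.cayley (𝓟 := 𝓟) (x * g) s hs
    rwa [mul_assoc] at this
  | vertical P g k =>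
    rw [hpt, hpt]; exact .vertical P _ k
  | horizontal P g g' k h =>
    rw [hpt, hpt]
    refine .horizontal P _ _ k (le_trans ?_ h)
    exact SimpleGraph.Hom.edist_le (X := SimpleGraph.mulCayley (S ∩ P.1 : Set G))
      ⟨fun y => x * y, by
        intro a b hab
        rw [SimpleGraph.mulCayley_adj'] at hab ⊢
        obtain ⟨hne, s, hs, h⟩ := hab
        exact ⟨fun h => hne (mul_left_cancel h), s, hs, by simpa [mul_assoc] using h⟩⟩ g g'

theorem cuspedGraph_adj_smul {𝓟 : Set (Subgroup G)} {S : Set G} (x : G) {v w : CuspedVertex 𝓟}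
    (h : (cuspedGraph 𝓟 S).Adj v w) : (cuspedGraph 𝓟 S).Adj (x • v) (x • w) :=
  ⟨fun e => h.1 (MulAction.injective x e), h.2.imp (CuspedRel.smul x) (CuspedRel.smul x)⟩

/-- The 1-skeleton of the cusped space with each edge replaced by two, one for each choice of
orientation, so that `G` acts freely: geometric edges are ordered pairs of adjacent vertices. -/
def freeCuspedGraph (𝓟 : Set (Subgroup G)) (S : Set G) : SGraph.{u} where
  V := CuspedVertex 𝓟
  E := {d : (CuspedVertex 𝓟 × CuspedVertex 𝓟) × Bool // (cuspedGraph 𝓟 S).Adj d.1.1 d.1.2}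
  src d := if d.1.2 then d.1.1.1 else d.1.1.2
  rev d := ⟨(d.1.1, !d.1.2), d.2⟩
  rev_rev d := by simp
  rev_ne d h := by simpa using congrArg (fun d => d.1.2) h

instance (𝓟 : Set (Subgroup G)) (S : Set G) : SGraph.FreeAction G (freeCuspedGraph 𝓟 S) where
  actV := inferInstanceAs (MulAction G (CuspedVertex 𝓟))
  actE :=
    { smul := fun x d => ⟨((x • d.1.1.1, x • d.1.1.2), d.1.2), cuspedGraph_adj_smul x d.2⟩
      one_smul := fun d => Subtype.ext (Prod.ext (Prod.ext
        (one_smul G d.1.1.1) (one_smul G d.1.1.2)) rfl)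
      mul_smul := fun x y d => Subtype.ext (Prod.ext (Prod.ext
        (mul_smul x y d.1.1.1) (mul_smul x y d.1.1.2)) rfl) }
  src_smul := by
    rintro x ⟨⟨⟨v, w⟩, b⟩, h⟩
    cases b <;> rfl
  rev_smul x d := rfl
  free := by
    rintro x (g | ⟨P, g, k⟩) h
    · exact mul_eq_right.1 (CuspedVertex.base.inj h)
    · exact mul_eq_right.1 (CuspedVertex.horo.inj h).2.1
  no_inversion := by
    rintro x ⟨⟨⟨v, w⟩, b⟩, h⟩ he
    have hb : b = !b := congrArg (fun d => d.1.2) he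
    cases b <;> simp at hb

end Cusped

section Hull

/-- A graph with a free action of `G`, a base vertex and a collection of horoballs. A horoball is
given by the sequence of vertex sets of the horoballs nested in it: `B n` is its part of depth `≥ n`. -/
structure AmbientGraph (G : Type u) [Group G] where
  graph : SGraph.{u}
  action : SGraph.FreeAction G graph
  base : graph.V
  horoballs : Set (ℕ → Set graph.V)

attribute [instance] AmbientGraph.action

variable {G : Type u} [Group G]

/-- The cusped space with its free `G`-action, the base vertex `1`, and one horoball for each coset
`t P`, with `P ∈ 𝓟`. -/
def AmbientGraph.cusped (𝓟 : Set (Subgroup G)) (S : Set G) : AmbientGraph G where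
  graph := freeCuspedGraph 𝓟 S
  action := inferInstance
  base := CuspedVertex.base 1
  horoballs := {B | ∃ (P : 𝓟) (t : G),
    B = fun n => {v | ∃ p ∈ P.1, ∃ k, n ≤ k ∧ v = CuspedVertex.pt P (t * p) k}}

/-- The graphs on which `(G, 𝓟)` is considered: if `𝓟` is empty, any connected graph with a free
cocompact action of `G` and any base vertex; otherwise the cusped space. -/
inductive AmbientGraph.IsAdmissible (𝓟 : Set (Subgroup G)) : AmbientGraph G → Prop
  | cocompact (A : AmbientGraph G) (h𝓟 : 𝓟 = ∅) (connected : A.graph.Connected)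
      (finite_verts : Finite (A.graph.quotient G).V)
      (finite_edges : Finite (A.graph.quotient G).E)
      (no_horoballs : A.horoballs = ∅) : IsAdmissible 𝓟 A
  | cusped (h𝓟 : 𝓟.Nonempty) (S : Set G) (hS : IsCompatibleGenSet 𝓟 S) :
      IsAdmissible 𝓟 (AmbientGraph.cusped 𝓟 S)

variable (A : AmbientGraph G) (H : Subgroup G)

/-- The limit set of `H`: the boundary points that are limits of sequences in the `H`-orbit of the
base vertex. -/
def AmbientGraph.limitSet : Set A.graph.simple.GromovBoundary :=
  {ξ | ∃ (γ : A.graph.simple.GeodesicRay) (h : ℕ → H), Quotient.mk _ γ = ξ ∧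
    Filter.Tendsto
      (fun m : ℕ × ℕ => A.graph.simple.gromovProd A.base (h m.1 • A.base) (γ.1 m.2))
      Filter.atTop Filter.atTop}

/-- Bi-infinite geodesics. A geodesic with both endpoints in the boundary is, up to
parametrization, a sequence of edges. -/
structure AmbientGraph.GeodesicLine where
  vert : ℤ → A.graph.V
  edge : ℤ → A.graph.E
  src_edge : ∀ n, A.graph.src (edge n) = vert n
  tgt_edge : ∀ n, A.graph.tgt (edge n) = vert (n + 1)
  geodesic : ∀ (m : ℤ) (k : ℕ), A.graph.simple.dist (vert m) (vert (m + k)) = k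

/-- The forward ray of a geodesic line. -/
def AmbientGraph.GeodesicLine.pos {A : AmbientGraph G} (γ : A.GeodesicLine) :
    A.graph.simple.GeodesicRay :=
  ⟨fun n => γ.vert n, fun m k => by simpa using γ.geodesic m k⟩

/-- The backward ray of a geodesic line. -/
def AmbientGraph.GeodesicLine.neg {A : AmbientGraph G} (γ : A.GeodesicLine) :
    A.graph.simple.GeodesicRay :=
  ⟨fun n => γ.vert (-n), fun m k => by
    have := γ.geodesic (-((m + k : ℕ) : ℤ)) k
    rw [SimpleGraph.dist_comm]
    convert this using 3
    push_cast; ring⟩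

/-- `Z` is an `R`-hull for `H` acting on the graph. In `geodesic_edges`, the `R`-neighbourhood of `γ`
meets the interior of an edge not on `γ` exactly if one of its end vertices is at distance `< R` from
a vertex of `γ`. In `horoball`, some horoball nested in `B` is contained in `Z`. -/
structure AmbientGraph.IsHull (𝓓 : Set (Subgroup H)) (R : ℝ)
    (Z : SGraph.InvSubgraph H A.graph) : Prop where
  connected : Z.graph.Connected
  base_mem : A.base ∈ Z.verts
  geodesic_edges : ∀ γ : A.GeodesicLine,
    Quotient.mk _ γ.pos ∈ A.limitSet H → Quotient.mk _ γ.neg ∈ A.limitSet H →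
    (∀ n, γ.edge n ∈ Z.edges) ∧
    ∀ e n, (A.graph.simple.dist (A.graph.src e) (γ.vert n) : ℝ) < R → e ∈ Z.edges
  horoball : ∀ B ∈ A.horoballs, {h : H | (fun v => h • v) '' B 0 = B 0}.Infinite →
    ∃ n, B n ⊆ Z.verts ∧ ∀ e, A.graph.src e ∈ B n → A.graph.tgt e ∈ B n → e ∈ Z.edges
  wgf : Z.graph.IsWGF H 𝓓

end Hull

/-! The sets of `n` defining height and multiplicity coincide. Write o for the base vertex.

From multiplicity to height: let `p` be a vertex of S_n, lift each coordinate to a vertex y_i of the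
hull, and choose g_i with g_i y_i = y_0. As the action is free and the coordinates are distinct, the
cosets g_i H are distinct. A loop in S_n lifts at y_i to a path ending at k_i y_i. The
g_i-translates of these lifts all start at y_0 and cover the same path of Γ/G, so they end at the
same vertex, and all g_i k_i g_i⁻¹ agree. Thus an infinite image of τ gives an infinite intersection
of conjugates (`exists_height_of_multiplicity`).

From height to multiplicity: let J = ⋂ g_i H g_i⁻¹ be infinite. A path from x to j x (j ∈ J) inside
every translate g_i Z̃ projects to a loop in S_n, and its τ-images are conjugates of j. So it
suffices to join one x to j x in this way for infinitely many j ∈ J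
(`exists_multiplicity_of_paths`). There are two cases.

If some f ∈ J satisfies d(o, f²o) > d(o, fo) + 3δ, then the powers of f converge to the two ends of
a geodesic line γ (`exists_axis`). The ends of g_i⁻¹γ are limit points of H, so the R-neighbourhood
of γ lies in every g_i Z̃. Each f^k γ(0) is within 4δ + 1 < R of γ (`exists_near_axis`): follow γ,
then cross over.

If no f ∈ J does, then each g ∈ J moves points far out on the first half of a geodesic [o, ho], h ∈
J, by at most 16δ (`dist_smul_le`). The action being free and the graph locally finite, a point in a
fixed cocompact region is moved this little by only boundedly many elements. As J is infinite, such
points leave the region. This is absurd if the action is cocompact. In the cusped space it forces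
the geodesic deep into a horoball, and J preserves one horoball (`exists_horoball_of_noHyperbolic`).
The hull contains a nested part of each translate of that horoball by g_i⁻¹, and a common deep
level, which is connected, supplies the paths. -/

namespace SGraph

/-! ### Lifts of conjugated loops -/

section Covering

variable {K : Type v} [Group K] {X : SGraph.{u}} [FreeAction K X]

/-- The lift from `b` runs along `m`, follows the lift from `y` to `k • y`, and returns along the
translate of `m` by `k`; so conjugating by a path does not change the deck element. -/
theorem LiftsTo.conj {b y : X.V} {m : List X.E} {l : List (X.quotient K).E} {k : K}
    (hm : X.IsPath b m y) (h : LiftsTo K X y l k) :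
    LiftsTo K X b (m.map (X.proj K).onE ++ l ++
      (X.quotient K).revPath (m.map (X.proj K).onE)) k := by
  obtain ⟨m', hm', rfl⟩ := h
  refine ⟨m ++ m' ++ (X.revPath m).map (k • ·), ?_, ?_⟩
  · rw [isPath_append]
    exact ⟨_, (X.isPath_append _ _ _ _).2 ⟨_, hm, hm'⟩,
      X.smul_isPath K (X.isPath_revPath _ _ _ hm)⟩
  · rw [List.map_append, List.map_append, proj_smul]
    simp only [revPath, List.map_reverse, List.map_map, Function.comp_def]
    congr 2

theorem deckHom_mk {b : X.V} {l : List (X.quotient K).E}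
    (h : (X.quotient K).IsPath ((X.proj K).onV b) l ((X.proj K).onV b)) {k : K}
    (hk : LiftsTo K X b l k) : X.deckHom K b (FundGroup.mk l h) = k :=
  (deckElt_spec b ⟨l, h⟩).unique hk

end Covering

/-! ### Loops in S_n and intersections of conjugates -/

namespace InvSubgraph

variable {G : Type v} [Group G] {H : Subgroup G} {Γ : SGraph.{u}} [FreeAction G Γ]
  (Z : InvSubgraph H Γ)

theorem isPath_val {a b : Z.graph.V} {m : List Z.graph.E} (h : Z.graph.IsPath a m b) :
    Γ.IsPath a.1 (m.map Subtype.val) b.1 := by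
  induction m generalizing a with
  | nil => exact congrArg Subtype.val h
  | cons e m ih => exact ⟨congrArg Subtype.val h.1, ih h.2⟩

theorem isPath_of_forall_mem {a b : Γ.V} {l : List Γ.E} (h : Γ.IsPath a l b)
    (hl : ∀ e ∈ l, e ∈ Z.edges) (ha : a ∈ Z.verts) :
    ∃ (hb : b ∈ Z.verts) (m : List Z.graph.E), m.map Subtype.val = l ∧
      Z.graph.IsPath ⟨a, ha⟩ m ⟨b, hb⟩ := by
  induction l generalizing a with
  | nil =>
    obtain rfl : a = b := h
    exact ⟨ha, [], rfl, rfl⟩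
  | cons e l ih =>
    have he : e ∈ Z.edges := hl e (by simp)
    obtain ⟨hb, m, hm, hp⟩ := ih h.2 (fun e' he' => hl e' (by simp [he']))
      (Z.src_mem _ (Z.rev_mem _ he))
    exact ⟨hb, ⟨e, he⟩ :: m, congrArg (List.cons e) hm, Subtype.ext h.1, hp⟩

variable {Z} {b : Z.graph.V}
  {σ : ∀ z : (Z.graph.quotient H).V,
    {l // (Z.graph.quotient H).IsPath ((Z.graph.proj H).onV b) l z}}

/-- The endpoint of a lift of `σ z`, through which `tau` can be computed. -/
theorem exists_tau_eq (n : ℕ) [NeZero n] (p : (Z.pullback n).V) (i : Fin n) :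
    ∃ y : Z.graph.V, (Z.graph.proj H).onV y = p.1 i ∧
      ∀ (l : List (Z.pullback n).E) (hl : (Z.pullback n).IsPath p l p) (k : H),
        LiftsTo H Z.graph y (l.map (Z.coord n i).onE) k →
          Z.tau b σ n p i (FundGroup.mk l hl) = k := by
  obtain ⟨m, y, hm, hml, hy⟩ := Z.graph.exists_lift H _ b _ (σ (p.1 i)).2
  refine ⟨y, hy, fun l hl k hk => ?_⟩
  have h := hk.conj hm
  rw [hml] at h
  exact deckHom_mk _ h

theorem exists_height_of_multiplicity {n : ℕ} [NeZero n] {p : (Z.pullback n).V}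
    (hp : ∀ i, ((Z.tau b σ n p i).range : Set H).Infinite) :
    ∃ g : Fin n → G, Function.Injective (fun i => (g i : G ⧸ H)) ∧
      ((⨅ i, H.map (MulAut.conj (g i)).toMonoidHom : Subgroup G) : Set G).Infinite := by
  choose y hy hτ using fun i => exists_tau_eq (b := b) (σ := σ) n p i
  have h0 : ∀ i, ∃ g : G, g • (y i).1 = (y 0).1 := fun i => by
    have := p.2.1 0 i
    rw [← hy, ← hy] at this
    exact (Γ.proj_onV_eq G).1 this
  choose g hg using h0
  refine ⟨g, fun i j hij => ?_, ?_⟩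
  · refine p.2.2 ?_
    rw [← hy, ← hy]
    have hmem : (g i)⁻¹ * g j ∈ H := QuotientGroup.eq.1 hij
    refine (Z.graph.proj_onV_eq H).2 ⟨⟨_, hmem⟩, Subtype.ext ?_⟩
    change ((g i)⁻¹ * g j) • (y j).1 = (y i).1
    rw [mul_smul, hg, ← hg i, inv_smul_smul]
  -- Infinitude of a single image suffices here: conjugation by `g 0` embeds it in the intersection.
  · have hsub : (fun k : H => g 0 * k * (g 0)⁻¹) '' ((Z.tau b σ n p 0).range : Set H) ⊆
        ((⨅ i, H.map (MulAut.conj (g i)).toMonoidHom : Subgroup G) : Set G) := by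
      rintro _ ⟨_, ⟨⟨l, hl⟩, rfl⟩, rfl⟩
      have hlift : ∀ i, ∃ k, LiftsTo H Z.graph (y i) (l.map (Z.coord n i).onE) k := fun i => by
        have h1 : (Z.graph.quotient H).IsPath ((Z.graph.proj H).onV (y i))
            (l.map (Z.coord n i).onE) ((Z.graph.proj H).onV (y i)) := by
          have := (Z.coord n i).isPath_map hl
          rw [hy]; exact this
        exact exists_liftsTo ⟨_, h1⟩
      choose k hk using hlift
      change g 0 * (Z.tau b σ n p 0 (FundGroup.mk l hl)) * (g 0)⁻¹ ∈ _
      rw [hτ 0 l hl _ (hk 0)]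
      refine Subgroup.mem_iInf.2 fun i => ⟨k i, (k i).2, ?_⟩
      -- After translation by `g i`, every coordinate gives a lift from `y 0` of one and the same
      -- path of Γ/G, so uniqueness of lifts identifies the endpoints.
      have key : ∀ i, ∃ m, Γ.IsPath (y 0).1 m ((g i * k i * (g i)⁻¹) • (y 0).1) ∧
          m.map (Γ.proj G).onE = l.map (fun e => Z.immersion.onE (e.1 0)) := fun i => by
        obtain ⟨m, hm, hml⟩ := hk i
        have h2 := Γ.smul_isPath G (k := g i) (Z.isPath_val hm)
        rw [hg] at h2
        refine ⟨(m.map Subtype.val).map (g i • ·), ?_, ?_⟩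
        · convert h2 using 1
          rw [mul_smul, mul_smul, ← hg i, inv_smul_smul]
          rfl
        · rw [proj_smul]
          have h3 := congrArg (List.map Z.immersion.onE) hml
          rw [List.map_map, List.map_map] at h3
          exact (List.map_map (f := (Subtype.val : Z.graph.E → Γ.E))).trans
            (h3.trans (List.map_congr_left fun e _ => e.2.1 i 0))
      obtain ⟨m, hm, hml⟩ := key i
      obtain ⟨m', hm', hml'⟩ := key 0
      have h4 := Γ.lift_unique G hm hm' (hml.trans hml'.symm)
      have h5 := FreeAction.free _ _ (by rw [mul_smul, h4, inv_smul_smul] :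
        ((g 0 * k 0 * (g 0)⁻¹)⁻¹ * (g i * k i * (g i)⁻¹)) • (y 0).1 = (y 0).1)
      exact (inv_mul_eq_one.1 h5).symm
    refine Set.Infinite.mono hsub ((hp 0).image ?_)
    intro k _ k' _ h
    exact Subtype.ext (mul_left_cancel (mul_right_cancel h))

/-- A vertex or edge lying in every translate g_i Z̃ gives the tuple of the classes of its
g_i⁻¹-translates, with distinct entries because the action is free and the cosets are distinct.
Paths from `x` to `j • x` thus map to S_n, and they close up because g_i⁻¹ j g_i ∈ H. -/
theorem exists_multiplicity_of_paths {n : ℕ} [NeZero n] {g : Fin n → G}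
    (hg : Function.Injective (fun i => (g i : G ⧸ H))) {x : Γ.V}
    (hx : ∀ i, (g i)⁻¹ • x ∈ Z.verts) {J : Set G} (hJ : J.Infinite)
    (hJH : ∀ j ∈ J, ∀ i, (g i)⁻¹ * j * g i ∈ H)
    (hpath : ∀ j ∈ J, ∃ l, Γ.IsPath x l (j • x) ∧ ∀ e ∈ l, ∀ i, (g i)⁻¹ • e ∈ Z.edges) :
    ∃ p : (Z.pullback n).V, ∀ i, ((Z.tau b σ n p i).range : Set H).Infinite := by
  have hinj : ∀ {i j : Fin n} {h : H} {v : Γ.V}, (h : G) • (g j)⁻¹ • v = (g i)⁻¹ • v → i = j := by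
    intro i j h v e
    have h1 : (g i * (h * (g j)⁻¹)) • v = v := by rw [mul_smul, mul_smul, e, smul_inv_smul]
    have h2 := FreeAction.free _ _ h1
    refine hg (QuotientGroup.eq.2 ?_)
    have : (g i)⁻¹ * g j = h := by
      have : g i * h = g j := by rwa [← mul_assoc, mul_inv_eq_one] at h2
      rw [← this]; group
    rw [this]; exact h.2
  let vert : ∀ v : Γ.V, (∀ i, (g i)⁻¹ • v ∈ Z.verts) → (Z.pullback n).V := fun v hv =>
    ⟨fun i => (Z.graph.proj H).onV ⟨(g i)⁻¹ • v, hv i⟩,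
      fun i j => (Γ.proj_onV_eq G).2 ⟨(g i)⁻¹ * g j, by simp [mul_smul]⟩, by
      intro i j hij
      obtain ⟨h, hh⟩ := (Z.graph.proj_onV_eq H).1 hij
      exact hinj (congrArg Subtype.val hh : (h : G) • (g j)⁻¹ • v = (g i)⁻¹ • v)⟩
  let edge : ∀ e : Γ.E, (∀ i, (g i)⁻¹ • e ∈ Z.edges) → (Z.pullback n).E := fun e he =>
    ⟨fun i => (Z.graph.proj H).onE ⟨(g i)⁻¹ • e, he i⟩,
      fun i j => (Γ.proj_onE_eq G).2 ⟨(g i)⁻¹ * g j, by simp [mul_smul]⟩, by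
      intro i j hij
      obtain ⟨h, hh⟩ := (Z.graph.proj_onE_eq H).1 hij
      have h1 : (h : G) • (g j)⁻¹ • e = (g i)⁻¹ • e := congrArg Subtype.val hh
      have h2 := congrArg Γ.src h1
      simp only [FreeAction.src_smul] at h2
      exact hinj h2⟩
  have hsrc : ∀ e he hv, (Z.pullback n).src (edge e he) = vert (Γ.src e) hv := fun e he hv =>
    Subtype.ext (funext fun i => congrArg (Z.graph.proj H).onV
      (Subtype.ext (FreeAction.src_smul (g i)⁻¹ e)))
  have hrev : ∀ e he he', (Z.pullback n).rev (edge e he) = edge (Γ.rev e) he' := fun e he he' =>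
    Subtype.ext (funext fun i => congrArg (Z.graph.proj H).onE
      (Subtype.ext (FreeAction.rev_smul (g i)⁻¹ e)))
  have hsmem : ∀ e, (∀ i, (g i)⁻¹ • e ∈ Z.edges) → ∀ i, (g i)⁻¹ • Γ.src e ∈ Z.verts :=
    fun e he i => by rw [← FreeAction.src_smul]; exact Z.src_mem _ (he i)
  have hrmem : ∀ e, (∀ i, (g i)⁻¹ • e ∈ Z.edges) → ∀ i, (g i)⁻¹ • Γ.rev e ∈ Z.edges :=
    fun e he i => by rw [← FreeAction.rev_smul]; exact Z.rev_mem _ (he i)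
  have hlift : ∀ (l : List Γ.E) (v w : Γ.V) (hv : ∀ i, (g i)⁻¹ • v ∈ Z.verts), Γ.IsPath v l w →
      (∀ e ∈ l, ∀ i, (g i)⁻¹ • e ∈ Z.edges) → ∃ (hw : ∀ i, (g i)⁻¹ • w ∈ Z.verts)
        (L : List (Z.pullback n).E), (Z.pullback n).IsPath (vert v hv) L (vert w hw) ∧
        ∀ i, ∃ m : List Z.graph.E, m.map Subtype.val = l.map ((g i)⁻¹ • ·) ∧
          L.map (Z.coord n i).onE = m.map (Z.graph.proj H).onE := by
    intro l
    induction l with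
    | nil =>
      rintro v _ hv rfl -
      exact ⟨hv, [], rfl, fun i => ⟨[], rfl, rfl⟩⟩
    | cons e l ih =>
      rintro v w hv ⟨rfl, h2⟩ hl
      have he := hl e (by simp)
      obtain ⟨hw, L, hL, hm⟩ := ih (Γ.tgt e) w (hsmem _ (hrmem _ he)) h2
        (fun e' he' => hl e' (by simp [he']))
      refine ⟨hw, edge e he :: L, ⟨hsrc _ _ _, ?_⟩, fun i => ?_⟩
      · have : (Z.pullback n).tgt (edge e he) = vert (Γ.tgt e) (hsmem _ (hrmem _ he)) := by
          rw [tgt, hrev e he (hrmem _ he), hsrc]; rfl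
        rw [this]; exact hL
      · obtain ⟨m, h3, h4⟩ := hm i
        exact ⟨⟨(g i)⁻¹ • e, he i⟩ :: m, congrArg (List.cons _) h3,
          congrArg (List.cons _) h4⟩
  refine ⟨vert x hx, fun i => ?_⟩
  obtain ⟨y, hy, hτ⟩ := exists_tau_eq (b := b) (σ := σ) n (vert x hx) i
  obtain ⟨k, hk⟩ := (Z.graph.proj_onV_eq H).1 hy
  have hky : y.1 = (k : G) • (g i)⁻¹ • x := (congrArg Subtype.val hk).symm
  -- The lift `y` at which τ is computed is only an H-translate of g_i⁻¹ x; the resulting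
  -- conjugation by `k` does not affect infinitude.
  have hsub : (fun j : G => (k : G) * ((g i)⁻¹ * j * g i) * (k : G)⁻¹) '' J ⊆
      Subtype.val '' ((Z.tau b σ n (vert x hx) i).range : Set H) := by
    rintro _ ⟨j, hj, rfl⟩
    obtain ⟨l, hl, hlZ⟩ := hpath j hj
    obtain ⟨hw, L, hL, hm⟩ := hlift l x (j • x) hx hl hlZ
    have hend : vert (j • x) hw = vert x hx := Subtype.ext (funext fun i' =>
      (Z.graph.proj_onV_eq H).2 ⟨⟨_, hJH j hj i'⟩, Subtype.ext (by
        change ((g i')⁻¹ * j * g i') • (g i')⁻¹ • x = (g i')⁻¹ • j • x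
        simp [mul_smul])⟩)
    rw [hend] at hL
    obtain ⟨m, hm1, hm2⟩ := hm i
    let k' : H := k * ⟨_, hJH j hj i⟩ * k⁻¹
    refine ⟨k', ⟨FundGroup.mk L hL, hτ L hL k' ?_⟩, rfl⟩
    have h6 : Γ.IsPath ((g i)⁻¹ • x) (m.map Subtype.val) ((g i)⁻¹ • j • x) := by
      rw [hm1]; exact Γ.smul_isPath G hl
    obtain ⟨hb, m', hm', h7⟩ := Z.isPath_of_forall_mem h6 (by
      intro e he
      obtain ⟨e', -, rfl⟩ := List.mem_map.1 he
      exact e'.2) (hx i)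
    obtain rfl : m' = m := (List.map_injective_iff.2 Subtype.val_injective) hm'
    have h8 := Z.graph.smul_isPath H (k := k) h7
    refine ⟨m'.map (k • ·), ?_, by rw [proj_smul, hm2]⟩
    let x' : Z.graph.V := ⟨(g i)⁻¹ • j • x, hb⟩
    have e2 : k • x' = k' • y := by
      refine Subtype.ext ?_
      change (k : G) • (g i)⁻¹ • j • x = ((k : G) * ((g i)⁻¹ * j * g i) * (k : G)⁻¹) • y.1
      rw [hky]; simp [mul_smul]
    rwa [hk, show k • _ = _ from e2] at h8
  refine Set.Infinite.of_image _ (Set.Infinite.mono hsub (hJ.image ?_))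
  intro j _ j' _ h
  exact mul_left_cancel (mul_right_cancel (mul_left_cancel (mul_right_cancel h)))

/-- The converse of `h` holds for every invariant subgraph, so the two suprema are taken over the
same set. -/
theorem height_eq_multiplicity
    (h : ∀ (n : ℕ) [NeZero n] (g : Fin n → G), Function.Injective (fun i => (g i : G ⧸ H)) →
      ((⨅ i, H.map (MulAut.conj (g i)).toMonoidHom : Subgroup G) : Set G).Infinite →
      ∃ p : (Z.pullback n).V, ∀ i, ((Z.tau b σ n p i).range : Set H).Infinite) :
    sSup {N : ℕ∞ | ∃ n : ℕ, N = n ∧ 0 < n ∧ ∃ g : Fin n → G,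
      Function.Injective (fun i => (g i : G ⧸ H)) ∧
      ((⨅ i, H.map (MulAut.conj (g i)).toMonoidHom : Subgroup G) : Set G).Infinite} =
      Z.multiplicity b σ := by
  refine congrArg sSup (Set.ext fun N => ⟨?_, ?_⟩)
  · rintro ⟨n, hN, hn, g, hg, hinf⟩
    have : NeZero n := ⟨hn.ne'⟩
    exact ⟨n, this, hN, h n g hg hinf⟩
  · rintro ⟨n, hn, hN, p, hp⟩
    exact ⟨n, hN, Nat.pos_of_ne_zero hn.out, exists_height_of_multiplicity hp⟩

end InvSubgraph

end SGraph

namespace SimpleGraph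

/-! ### Geodesics and Gromov products in hyperbolic graphs -/

section Hyperbolic

variable {V : Type u} {X : SimpleGraph V} {δ : ℝ}

theorem Connected.exists_geodesic (hX : X.Connected) (x y : V) :
    ∃ c : ℕ → V, c 0 = x ∧ c (X.dist x y) = y ∧
      ∀ i k, i + k ≤ X.dist x y → X.dist (c i) (c (i + k)) = k := by
  obtain ⟨p, hp⟩ := hX.exists_walk_length_eq_dist x y
  have hle : ∀ i k, i + k ≤ X.dist x y → X.dist (p.getVert i) (p.getVert (i + k)) ≤ k := by
    intro i k
    induction k with
    | zero => simp
    | succ k ih =>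
      intro h
      have h1 := ih (by omega)
      have h2 : X.dist (p.getVert (i + k)) (p.getVert (i + k + 1)) = 1 :=
        dist_eq_one_iff_adj.2 (p.adj_getVert_succ (by omega))
      have h3 := hX.dist_triangle (u := p.getVert i) (v := p.getVert (i + k))
        (w := p.getVert (i + k + 1))
      rw [← add_assoc]
      omega
  refine ⟨p.getVert, p.getVert_zero, by rw [← hp]; exact p.getVert_length, fun i k h => ?_⟩
  -- The upper bounds for the three consecutive pieces add up to the full distance, so none of them
  -- can be strict.
  have h1 := hle 0 i (by omega)
  have h2 := hle i k h
  have h3 := hle (i + k) (X.dist x y - (i + k)) (by omega)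
  rw [Nat.add_sub_cancel' h, ← hp, p.getVert_length, hp] at h3
  rw [Nat.zero_add, p.getVert_zero] at h1
  have h4 := hX.dist_triangle (u := x) (v := p.getVert i) (w := y)
  have h5 := hX.dist_triangle (u := p.getVert i) (v := p.getVert (i + k)) (w := y)
  omega

namespace IsGromovHyperbolic

theorem nonneg (hX : X.IsGromovHyperbolic δ) : 0 ≤ δ := by
  obtain ⟨x⟩ := hX.1.nonempty
  have := hX.2 x x x x
  simp at this
  linarith

theorem triangle (hX : X.IsGromovHyperbolic δ) (x y z : V) :
    (X.dist x z : ℝ) ≤ X.dist x y + X.dist y z := by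
  exact_mod_cast hX.1.dist_triangle

/-- The four-point inequality in the form (x|z) ≥ min((x|y), (y|z)) − δ, with a common lower bound
in place of the minimum. -/
theorem gromovProd_ge (hX : X.IsGromovHyperbolic δ) {o x y z : V} {r : ℝ}
    (hxy : r ≤ X.gromovProd o x y) (hyz : r ≤ X.gromovProd o y z) :
    r - δ ≤ X.gromovProd o x z := by
  have h := hX.2 x z y o
  unfold gromovProd at *
  rw [X.dist_comm (u := z) (v := o), X.dist_comm (u := x) (v := o),
    X.dist_comm (u := z) (v := y), X.dist_comm (u := y) (v := o)] at h
  rcases le_max_iff.1 (sub_le_iff_le_add.2 h) with h | h <;> linarith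

theorem gromovProd_base (hX : X.IsGromovHyperbolic δ) (o o' x y : V) :
    X.gromovProd o x y - X.dist o o' ≤ X.gromovProd o' x y := by
  have h1 := hX.triangle o o' x
  have h2 := hX.triangle o o' y
  unfold gromovProd
  linarith

theorem gromovProd_right (hX : X.IsGromovHyperbolic δ) (o x y y' : V) :
    X.gromovProd o x y - X.dist y y' ≤ X.gromovProd o x y' := by
  have h1 := hX.triangle o y' y
  have h2 := hX.triangle x y y'
  rw [X.dist_comm (u := y') (v := y)] at h1
  unfold gromovProd
  linarith

end IsGromovHyperbolic

theorem gromovProd_comm (o x y : V) : X.gromovProd o x y = X.gromovProd o y x := by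
  unfold gromovProd
  rw [X.dist_comm (u := x) (v := y), add_comm (X.dist o x : ℝ)]

/-- The Gromov product measures, up to an additive error, the distance from `o` to a geodesic: apply
the four-point inequality at the point where a tripod for `o` and the two ends would branch. -/
theorem IsGromovHyperbolic.exists_near (hX : X.IsGromovHyperbolic δ) {c : ℕ → V} {d : ℕ}
    (hc : ∀ i k, i + k ≤ d → X.dist (c i) (c (i + k)) = k) (o : V) :
    ∃ i ≤ d, (X.dist o (c i) : ℝ) ≤ X.gromovProd o (c 0) (c d) + 1 + 2 * δ := by
  have h0 : (X.dist (c 0) (c d) : ℝ) = d := by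
    have := hc 0 d (by omega)
    rw [zero_add] at this
    exact_mod_cast this
  -- The branch point's distance from `c 0`. Rounding it down to a vertex costs the 1 in the bound.
  set r : ℝ := ((X.dist o (c 0) : ℝ) + d - X.dist o (c d)) / 2 with hr
  have t1 := hX.triangle (c 0) o (c d)
  have t2 := hX.triangle o (c 0) (c d)
  have t3 := hX.triangle o (c d) (c 0)
  rw [X.dist_comm (u := c 0) (v := o)] at t1
  rw [X.dist_comm (u := c d) (v := c 0)] at t3
  have hr0 : 0 ≤ r := by rw [hr]; linarith
  have hrd : r ≤ d := by rw [hr]; linarith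
  have hi1 := Nat.floor_le hr0
  have hi2 := Nat.lt_floor_add_one r
  set i := ⌊r⌋₊
  have hid : i ≤ d := by exact_mod_cast hi1.trans hrd
  refine ⟨i, hid, ?_⟩
  have e1 : (X.dist (c 0) (c i) : ℝ) = i := by
    have := hc 0 i (by omega)
    rw [zero_add] at this
    exact_mod_cast this
  have e2 : (X.dist (c i) (c d) : ℝ) = d - i := by
    have := hc i (d - i) (by omega)
    rw [Nat.add_sub_cancel' hid] at this
    rw [this, Nat.cast_sub hid]
  have h := hX.2 o (c i) (c 0) (c d)
  rw [X.dist_comm (u := c i) (v := c 0), e1, e2, h0] at h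
  unfold gromovProd
  rw [h0]
  rcases le_max_iff.1 (sub_le_iff_le_add.2 h) with h | h <;> linarith

open Filter in
-- Bounded Gromov products keep the geodesics [u_n, v_n] within ρ of `o`. Parametrized from a vertex
-- near `o`, they have a pointwise limit along a nonprincipal ultrafilter, by local finiteness.
-- Hence γ(±N) lies on [u_n, v_n] for arbitrarily large `n`, though not necessarily for all large
-- `n`.
theorem IsGromovHyperbolic.exists_line (hX : X.IsGromovHyperbolic δ)
    (hfin : ∀ (x : V) (n : ℕ), {y | X.dist x y ≤ n}.Finite) {o : V} {u v : ℕ → V} {B : ℝ}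
    (hB : ∀ n, X.gromovProd o (u n) (v n) ≤ B)
    (hu : Tendsto (fun n => (X.dist o (u n) : ℝ)) atTop atTop)
    (hv : Tendsto (fun n => (X.dist o (v n) : ℝ)) atTop atTop) :
    ∃ (γ : ℤ → V) (ρ : ℝ), (∀ (m : ℤ) (k : ℕ), X.dist (γ m) (γ (m + k)) = k) ∧
      ∀ N M : ℕ, ∃ n ≥ M, N - ρ ≤ X.gromovProd o (v n) (γ N) ∧
        N - ρ ≤ X.gromovProd o (u n) (γ (-N)) := by
  choose c hc0 hcd hc using fun n => hX.1.exists_geodesic (u n) (v n)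
  choose i hid hi using fun n => hX.exists_near (hc n) o
  set ρ : ℝ := B + 1 + 2 * δ with hρ
  have hnear : ∀ n, (X.dist o (c n (i n)) : ℝ) ≤ ρ := fun n => by
    have h1 := hi n
    have h2 := hB n
    rw [hc0, hcd] at h1
    linarith
  have e1 : ∀ n, ∀ k ≤ i n, (X.dist (c n (i n - k)) (c n (i n)) : ℝ) = k := fun n k hk => by
    have := hc n (i n - k) k (by have := hid n; omega)
    rw [Nat.sub_add_cancel hk] at this
    exact_mod_cast this
  have e2 : ∀ n k, i n + k ≤ X.dist (u n) (v n) →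
      (X.dist (c n (i n)) (c n (i n + k)) : ℝ) = k := fun n k hk => by
    exact_mod_cast hc n (i n) k hk
  have b1 : ∀ K : ℕ, ∀ᶠ n in atTop, K ≤ i n := fun K => by
    filter_upwards [hu.eventually_ge_atTop (K + ρ)] with n hn
    have h1 := e1 n (i n) le_rfl
    rw [Nat.sub_self, hc0] at h1
    have h2 := hX.triangle o (c n (i n)) (u n)
    rw [X.dist_comm (v := u n) (u := c n (i n))] at h2
    have h3 := hnear n
    exact_mod_cast (by linarith : (K : ℝ) ≤ i n)
  have b2 : ∀ K : ℕ, ∀ᶠ n in atTop, i n + K ≤ X.dist (u n) (v n) := fun K => by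
    filter_upwards [hv.eventually_ge_atTop (K + ρ)] with n hn
    have h1 := e2 n (X.dist (u n) (v n) - i n) (by have := hid n; omega)
    rw [Nat.add_sub_cancel' (hid n), hcd, Nat.cast_sub (hid n)] at h1
    have h2 := hX.triangle o (c n (i n)) (v n)
    have h3 := hnear n
    exact_mod_cast (by linarith : (i n : ℝ) + K ≤ X.dist (u n) (v n))
  -- Time 0 is the vertex near `o`. The truncation by `toNat` has no effect once `i n` is at least
  -- |k|, which holds for large `n` by `b1`.
  let w : ℕ → ℤ → V := fun n k => c n (i n + k).toNat
  have hw : ∀ (n : ℕ) (K : ℕ), K ≤ i n → i n + K ≤ X.dist (u n) (v n) → ∀ (m : ℤ) (k : ℕ),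
      m.natAbs ≤ K → (m + k).natAbs ≤ K → X.dist (w n m) (w n (m + k)) = k := by
    intro n K h1 h2 m k h3 h4
    have := hc n ((i n + m).toNat) k (by omega)
    rw [← this]
    simp only [w]
    congr 2
    omega
  have hwo : ∀ n, w n 0 = c n (i n) := fun n => by simp [w]
  have hlim : ∀ k : ℤ, ∃ x, ∀ᶠ n in (hyperfilter ℕ : Filter ℕ), w n k = x := by
    intro k
    let F : Set V := {y | X.dist o y ≤ ⌈ρ + k.natAbs⌉₊}
    have hF : ∀ᶠ n in (hyperfilter ℕ : Filter ℕ), w n k ∈ F := by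
      refine Nat.hyperfilter_le_atTop ?_
      filter_upwards [b1 k.natAbs, b2 k.natAbs] with n h1 h2
      have h3 : (X.dist (w n 0) (w n k) : ℝ) = k.natAbs := by
        rcases le_total 0 k with hk | hk
        · have := hw n _ h1 h2 0 k.natAbs (by simp) (by omega)
          rw [show (0 : ℤ) + k.natAbs = k by omega] at this
          exact_mod_cast this
        · have := hw n _ h1 h2 k k.natAbs le_rfl (by omega)
          rw [show k + k.natAbs = 0 by omega] at this
          rw [X.dist_comm]
          exact_mod_cast this
      have h4 := hX.triangle o (w n 0) (w n k)
      have h5 := hnear n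
      rw [← hwo] at h5
      have h6 := Nat.le_ceil (ρ + k.natAbs)
      change X.dist o (w n k) ≤ _
      exact_mod_cast (by linarith : (X.dist o (w n k) : ℝ) ≤ ⌈ρ + k.natAbs⌉₊)
    obtain ⟨x, -, hx⟩ := Ultrafilter.eq_pure_of_finite_mem
      (f := (hyperfilter ℕ).map (fun n => w n k)) (hfin o _) hF
    refine ⟨x, ?_⟩
    have : ({x} : Set V) ∈ (hyperfilter ℕ).map (fun n => w n k) := by rw [hx]; simp
    exact this
  choose γ hγ using hlim
  refine ⟨γ, ρ, fun m k => ?_, fun N M => ?_⟩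
  · obtain ⟨n, h1, h2, h3, h4⟩ := ((hγ m).and ((hγ (m + k)).and
      (((b1 (m.natAbs + k)).filter_mono Nat.hyperfilter_le_atTop).and
      ((b2 (m.natAbs + k)).filter_mono Nat.hyperfilter_le_atTop)))).exists
    rw [← h1, ← h2]
    exact hw n _ h3 h4 m k (by omega) (by omega)
  · obtain ⟨n, h1, h2, h3, h4, h5⟩ := ((hγ N).and ((hγ (-N)).and
      (((b1 N).filter_mono Nat.hyperfilter_le_atTop).and (((b2 N).filter_mono Nat.hyperfilter_le_atTop).and
      ((eventually_ge_atTop M).filter_mono Nat.hyperfilter_le_atTop))))).exists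
    have f1 : γ N = c n (i n + N) := by rw [← h1]; simp only [w]; congr 1
    have f2 : γ (-N) = c n (i n - N) := by rw [← h2]; simp only [w]; congr 1; omega
    refine ⟨n, h5, ?_, ?_⟩
    · have g1 := e2 n N h4
      have g2 := e2 n (X.dist (u n) (v n) - i n) (by have := hid n; omega)
      rw [Nat.add_sub_cancel' (hid n), hcd, Nat.cast_sub (hid n)] at g2
      have g3 := hc n (i n + N) (X.dist (u n) (v n) - (i n + N)) (by omega)
      rw [Nat.add_sub_cancel' h4, hcd] at g3
      have g4 : (X.dist (c n (i n + N)) (v n) : ℝ) = X.dist (u n) (v n) - (i n + N) := by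
        rw [g3, Nat.cast_sub h4]; push_cast; rfl
      have t1 := hX.triangle (c n (i n)) o (c n (i n + N))
      have t2 := hX.triangle (c n (i n)) o (v n)
      have t3 := hnear n
      rw [X.dist_comm (v := o)] at t1 t2
      rw [f1]
      unfold gromovProd
      rw [X.dist_comm (u := v n)]
      linarith
    · have g1 := e1 n N h3
      have g2 := e1 n (i n) le_rfl
      rw [Nat.sub_self, hc0] at g2
      have g3 := hc n 0 (i n - N) (by have := hid n; omega)
      rw [zero_add, hc0] at g3
      have g4 : (X.dist (u n) (c n (i n - N)) : ℝ) = i n - N := by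
        rw [g3, Nat.cast_sub h3]
      have t1 := hX.triangle (c n (i n - N)) o (c n (i n))
      have t2 := hX.triangle (u n) o (c n (i n))
      have t3 := hnear n
      rw [X.dist_comm (v := o)] at t1 t2
      rw [f2]
      unfold gromovProd
      linarith

end Hyperbolic

/-! ### Axes, and groups without elements satisfying the axis criterion -/

section Isometries

variable {V : Type u} {X : SimpleGraph V} {δ : ℝ} {G : Type v} [Group G] [MulAction G V]

theorem gromovProd_smul (hG : ∀ (g : G) (x y : V), X.dist (g • x) (g • y) = X.dist x y)
    (g : G) (o x y : V) : X.gromovProd (g • o) (g • x) (g • y) = X.gromovProd o x y := by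
  simp only [gromovProd, hG]

theorem dist_smul_left (hG : ∀ (g : G) (x y : V), X.dist (g • x) (g • y) = X.dist x y)
    (g : G) (x y : V) : X.dist (g • x) y = X.dist x (g⁻¹ • y) := by
  rw [← hG g⁻¹, inv_smul_smul]

namespace IsGromovHyperbolic

/-- The iterates of an isometry `f` with `d(o, f² o) > d(o, f o) + 3δ` converge to the ends of a
geodesic line. -/
theorem exists_axis (hX : X.IsGromovHyperbolic δ)
    (hG : ∀ (g : G) (x y : V), X.dist (g • x) (g • y) = X.dist x y)
    (hfin : ∀ (x : V) (n : ℕ), {y | X.dist x y ≤ n}.Finite) {o : V} {f : G}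
    (hf : (X.dist o (f • o) : ℝ) + 3 * δ < X.dist o ((f * f) • o)) :
    Function.Injective (fun n : ℕ => f ^ n) ∧ ∃ γ : ℤ → V,
      (∀ (m : ℤ) (k : ℕ), X.dist (γ m) (γ (m + k)) = k) ∧
      ∀ M : ℝ, ∃ n₀ : ℕ, ∀ m ≥ n₀, ∀ N ≥ n₀, M ≤ X.gromovProd o (f ^ m • o) (γ N) ∧
        M ≤ X.gromovProd o ((f ^ m)⁻¹ • o) (γ (-N)) := by
  have hδ := hX.nonneg
  set a : ℕ → ℝ := fun n => X.dist o (f ^ n • o) with ha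
  have ha0 : ∀ n, 0 ≤ a n := fun n => Nat.cast_nonneg _
  have hdist : ∀ n k : ℕ, (X.dist (f ^ n • o) (f ^ (n + k) • o) : ℝ) = a k := fun n k => by
    rw [pow_add, mul_smul, hG]
  -- The margin 3δ in the criterion is what makes ε exceed δ; this rules out the unwanted
  -- alternative of the four-point inequality in `hsup`.
  set ε : ℝ := a 2 - a 1 - 2 * δ with hε
  have hεδ : δ < ε := by
    have : a 1 + 3 * δ < a 2 := by simpa [ha, pow_two] using hf
    rw [hε]; linarith
  have hstep : ∀ n, a n + ε ≤ a (n + 1) := by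
    intro n
    induction n with
    | zero =>
      have : a 0 = 0 := by simp [ha]
      have h2 := hX.triangle o (f ^ 1 • o) (f ^ 2 • o)
      have h3 := hdist 1 1
      rw [this, hε]
      simp only [ha] at *
      linarith
    | succ n ih =>
      have h := hX.2 o (f ^ (n + 1) • o) (f ^ n • o) (f ^ (n + 2) • o)
      have h1 := hdist n 2
      have h2 := hdist (n + 1) 1
      have h3 := hdist n 1
      rw [X.dist_comm (u := f ^ (n + 1) • o) (v := f ^ n • o), h1, h3,
        show n + 2 = n + 1 + 1 from rfl, h2] at h
      change a (n + 1) + a 2 ≤ max (a n + a 1) (a (n + 1 + 1) + a 1) + 2 * δ at h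
      rcases le_max_iff.1 (sub_le_iff_le_add.2 h) with h | h <;> linarith
  have hgrow : ∀ n k, a n + k * ε ≤ a (n + k) := by
    intro n k
    induction k with
    | zero => simp
    | succ k ih =>
      have := hstep (n + k)
      rw [← add_assoc]
      push_cast
      linarith
  -- Displacements are superadditive up to a constant, so the Gromov product of f^n o and f^{-n} o
  -- stays bounded, as `exists_line` requires.
  have hsup : ∀ n k, a n + a k - a 1 - 2 * δ ≤ a (n + k) := by
    intro n k
    cases k with
    | zero =>
      have : a 0 = 0 := by simp [ha]
      have := ha0 1
      rw [add_zero]; linarith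
    | succ k =>
      have h := hX.2 o (f ^ (n + 1) • o) (f ^ n • o) (f ^ (n + (k + 1)) • o)
      have h1 := hdist n (k + 1)
      have h2 := hdist (n + 1) k
      have h3 := hdist n 1
      rw [show n + 1 + k = n + (k + 1) by omega] at h2
      rw [X.dist_comm (u := f ^ (n + 1) • o) (v := f ^ n • o), h1, h2, h3] at h
      change a (n + 1) + a (k + 1) ≤ max (a n + a k) (a (n + (k + 1)) + a 1) + 2 * δ at h
      have h4 := hstep n
      have h5 := hstep k
      rcases le_max_iff.1 (sub_le_iff_le_add.2 h) with h | h <;> linarith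
  have hinv : ∀ n, (X.dist o ((f ^ n)⁻¹ • o) : ℝ) = a n := fun n => by
    rw [X.dist_comm, dist_smul_left hG, inv_inv]
  have hεpos : 0 < ε := by linarith
  have hlin : ∀ n : ℕ, n * ε ≤ a n := fun n => by
    have h1 := hgrow 0 n
    have h2 := ha0 0
    rw [zero_add] at h1
    linarith
  have htend : Filter.Tendsto a Filter.atTop Filter.atTop :=
    Filter.tendsto_atTop_mono hlin
      (tendsto_natCast_atTop_atTop.atTop_mul_const hεpos)
  refine ⟨?_, ?_⟩
  · refine (strictMono_nat_of_lt_succ (f := a) fun n => ?_).injective.of_comp (f := fun g : G =>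
      (X.dist o (g • o) : ℝ)) (g := fun n : ℕ => f ^ n)
    have := hstep n
    linarith
  · obtain ⟨γ, ρ, hγ, hlim⟩ := hX.exists_line hfin (o := o) (u := fun n => (f ^ n)⁻¹ • o)
      (v := fun n => f ^ n • o) (B := (a 1 + 2 * δ) / 2) (fun n => by
        unfold gromovProd
        rw [hinv, dist_smul_left hG, inv_inv, ← mul_smul, ← pow_add]
        have := hsup n n
        simp only [ha] at *
        linarith) (by simpa only [hinv] using htend) htend
    refine ⟨γ, hγ, fun M => ?_⟩
    -- The first term makes products between orbit points at least M + δ, the second makes N − ρ at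
    -- least M + δ. The δ is spent on chaining the two.
    obtain ⟨n₀, hn₀⟩ := exists_nat_ge (max (2 * (M + δ) / ε) (M + δ + ρ))
    have hn1 := (le_max_left _ _).trans hn₀
    have hn2 := (le_max_right _ _).trans hn₀
    clear hn₀
    rw [div_le_iff₀ hεpos] at hn1
    refine ⟨n₀, fun m hm N hN => ?_⟩
    obtain ⟨n, hn, h1, h2⟩ := hlim N m
    obtain ⟨k, rfl⟩ := Nat.exists_eq_add_of_le hn
    have hm' : (n₀ : ℝ) * ε ≤ m * ε :=
      mul_le_mul_of_nonneg_right (by exact_mod_cast hm) hεpos.le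
    have hN' : (n₀ : ℝ) ≤ N := by exact_mod_cast hN
    have h3 := hgrow k m
    rw [add_comm k m] at h3
    have h4 := ha0 m
    -- `exists_line` controls only some n = m + k; linear growth of displacement bounds the product
    -- of f^m o and f^n o below by mε/2, whatever `k` is.
    have hp1 : M + δ ≤ X.gromovProd o (f ^ m • o) (f ^ (m + k) • o) := by
      unfold gromovProd
      rw [hdist]
      change _ ≤ (a m + a (m + k) - a k) / 2
      linarith
    have hp2 : M + δ ≤ X.gromovProd o ((f ^ m)⁻¹ • o) ((f ^ (m + k))⁻¹ • o) := by
      unfold gromovProd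
      rw [hinv, hinv, dist_smul_left hG, inv_inv, ← mul_smul]
      have : f ^ m * (f ^ (m + k))⁻¹ = (f ^ k)⁻¹ := by rw [add_comm, pow_add]; group
      rw [this, hinv]
      linarith
    have q1 := hX.gromovProd_ge hp1 (le_trans (by linarith) h1)
    have q2 := hX.gromovProd_ge hp2 (le_trans (by linarith) h2)
    exact ⟨by linarith, by linarith⟩

/-- The translate of γ by f^k has the same ends as γ, so each of its points is near γ. Of the bound,
2δ comes from the Gromov product at the point and 2δ + 1 from `exists_near`. -/
theorem exists_near_axis (hX : X.IsGromovHyperbolic δ)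
    (hG : ∀ (g : G) (x y : V), X.dist (g • x) (g • y) = X.dist x y) {o : V} {f : G} {γ : ℤ → V}
    (hγ : ∀ (m : ℤ) (k : ℕ), X.dist (γ m) (γ (m + k)) = k)
    (hlim : ∀ M : ℝ, ∃ n₀ : ℕ, ∀ m ≥ n₀, ∀ N ≥ n₀, M ≤ X.gromovProd o (f ^ m • o) (γ N) ∧
        M ≤ X.gromovProd o ((f ^ m)⁻¹ • o) (γ (-N))) (k : ℕ) :
    ∃ n, (X.dist (f ^ k • γ 0) (γ n) : ℝ) ≤ 4 * δ + 1 := by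
  have hδ := hX.nonneg
  set q := f ^ k with hq
  set x := q • γ 0 with hx
  set L : ℝ := ((X.dist o (q⁻¹ • o) : ℕ) : ℝ) with hL
  have hL' : (X.dist (q⁻¹ • o) o : ℝ) = L := by rw [X.dist_comm]
  have hL0 : 0 ≤ L := Nat.cast_nonneg _
  -- L pays for moving the base point to q⁻¹ o and d(o, x) for moving it to `x`. Of the remaining 4δ
  -- + 1, one δ goes into chaining, and 3δ + 1 is left at `x`.
  obtain ⟨n₀, hn₀⟩ := hlim (L + X.dist o x + 4 * δ + 1)
  have a1 := (hn₀ (n₀ + k) (by omega) n₀ le_rfl).1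
  have a2 := (hn₀ n₀ le_rfl n₀ le_rfl).1
  have b1 := (hn₀ n₀ le_rfl n₀ le_rfl).2
  have b2 := (hn₀ (n₀ + k) (by omega) n₀ le_rfl).2
  have c1 := hX.gromovProd_base o (q⁻¹ • o) (f ^ n₀ • o) (γ n₀)
  have c2 := hX.gromovProd_base o (q⁻¹ • o) ((f ^ (n₀ + k))⁻¹ • o) (γ (-n₀))
  rw [← gromovProd_smul hG q (q⁻¹ • o), smul_inv_smul, ← mul_smul] at c1 c2
  rw [show q * f ^ n₀ = f ^ (n₀ + k) by rw [hq, ← pow_add, add_comm]] at c1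
  rw [show q * (f ^ (n₀ + k))⁻¹ = (f ^ n₀)⁻¹ by rw [hq, pow_add]; group] at c2
  rw [gromovProd_comm] at a1 b1
  have d1 := hX.gromovProd_ge (r := X.dist o x + 4 * δ + 1) (o := o) (x := γ n₀)
    (y := f ^ (n₀ + k) • o) (z := q • γ n₀) (by linarith) (by linarith)
  have d2 := hX.gromovProd_ge (r := X.dist o x + 4 * δ + 1) (o := o) (x := γ (-n₀))
    (y := (f ^ n₀)⁻¹ • o) (z := q • γ (-n₀)) (by linarith) (by linarith)
  have f1 := hX.gromovProd_base o x (γ n₀) (q • γ n₀)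
  have f2 := hX.gromovProd_base o x (γ (-n₀)) (q • γ (-n₀))
  have e0 : X.gromovProd x (q • γ n₀) (q • γ (-n₀)) = 0 := by
    rw [hx, gromovProd_smul hG]
    unfold gromovProd
    have g1 := hγ 0 n₀
    have g2 := hγ (-n₀) n₀
    have g3 := hγ (-n₀) (n₀ + n₀)
    rw [zero_add] at g1
    rw [neg_add_cancel] at g2
    rw [show (-n₀ + ((n₀ + n₀ : ℕ) : ℤ)) = n₀ by push_cast; ring] at g3
    rw [g1, X.dist_comm, g2, X.dist_comm, g3]
    push_cast; ring
  -- Otherwise two applications of hyperbolicity would make the product at `x` of qγ(n₀) and qγ(−n₀)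
  -- positive, but `x` lies between them on a geodesic.
  have key : X.gromovProd x (γ (-n₀)) (γ n₀) ≤ 2 * δ := by
    by_contra! hcon
    obtain ⟨r, hr1, hr2⟩ := exists_between
      (lt_min hcon (by linarith : 2 * δ < 2 * δ + 1))
    have r1 := hr2.le.trans (min_le_left _ _)
    have r2 := hr2.le.trans (min_le_right _ _)
    have s1 := hX.gromovProd_ge (o := x) (x := γ (-n₀)) (y := γ n₀) (z := q • γ n₀) (r := r)
      r1 (by linarith)
    rw [gromovProd_comm] at s1
    have s2 := hX.gromovProd_ge (o := x) (x := q • γ n₀) (y := γ (-n₀)) (z := q • γ (-n₀))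
      (r := r - δ) s1 (by linarith)
    linarith
  obtain ⟨i, -, hi⟩ := hX.exists_near (c := fun i => γ (-n₀ + i)) (d := n₀ + n₀)
    (fun i k _ => by
      push_cast
      rw [← add_assoc]
      exact hγ (-n₀ + i) k) x
  refine ⟨-n₀ + i, hi.trans ?_⟩
  simp only [Nat.cast_zero, add_zero]
  rw [show (-n₀ + ((n₀ + n₀ : ℕ) : ℤ)) = n₀ by push_cast; ring]
  linarith

section NoHyperbolic

variable {J : Subgroup G} {o : V}

/-- A ping-pong argument. Failure of the criterion means that fo and f⁻¹o leave `o` in nearly the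
same direction for every f ∈ J. If go and ho diverged too early, then (gh)o and (gh)⁻¹o would set
out towards go and h⁻¹o, hence in different directions, although gh ∈ J. -/
theorem dist_smul_smul_le (hX : X.IsGromovHyperbolic δ)
    (hG : ∀ (g : G) (x y : V), X.dist (g • x) (g • y) = X.dist x y)
    (hJ : ∀ f ∈ J, (X.dist o ((f * f) • o) : ℝ) ≤ X.dist o (f • o) + 3 * δ)
    {g h : G} (hg : g ∈ J) (hh : h ∈ J) :
    (X.dist (g • o) (h • o) : ℝ) ≤ max (X.dist o (g • o) : ℝ) (X.dist o (h • o)) + 6 * δ := by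
  have hδ := hX.nonneg
  by_contra! hcon
  have hmax1 := le_max_left (X.dist o (g • o) : ℝ) (X.dist o (h • o))
  have hmax2 := le_max_right (X.dist o (g • o) : ℝ) (X.dist o (h • o))
  have hinv : ∀ f : G, X.dist o (f⁻¹ • o) = X.dist o (f • o) := fun f => by
    rw [X.dist_comm, dist_smul_left hG, inv_inv]
  have hself : ∀ f ∈ J, ((X.dist o (f • o) : ℝ) - 3 * δ) / 2 ≤
      X.gromovProd o (f⁻¹ • o) (f • o) := fun f hf => by
    unfold gromovProd
    rw [hinv, dist_smul_left hG, inv_inv, ← mul_smul]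
    have := hJ f hf
    linarith
  have hg1 := hself g hg
  have hh1 := hself h hh
  set p := X.gromovProd o (g • o) (h • o) with hp
  have hpd : (X.dist (g • o) (h • o) : ℝ) = X.dist o (g • o) + X.dist o (h • o) - 2 * p := by
    rw [hp]; unfold gromovProd; ring
  set A : ℝ := ((X.dist o (g • o) : ℕ) : ℝ) with hA
  set B : ℝ := ((X.dist o (h • o) : ℕ) : ℝ) with hB
  have pA : 2 * p + 6 * δ < A := by linarith
  have pB : 2 * p + 6 * δ < B := by linarith
  -- g⁻¹o shares the direction of go well past the place where go and ho diverge, so it diverges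
  -- from ho there too, up to δ.
  have q1 : X.gromovProd o (g⁻¹ • o) (h • o) ≤ p + δ := by
    by_contra! hc
    obtain ⟨r, hr1, hr2⟩ := exists_between
      (lt_min hc (by linarith : p + δ < (A - 3 * δ) / 2))
    have := hX.gromovProd_ge (o := o) (x := g • o) (y := g⁻¹ • o) (z := h • o) (r := r)
      (by rw [gromovProd_comm]; exact (hr2.le.trans (min_le_right _ _)).trans hg1)
      (hr2.le.trans (min_le_left _ _))
    linarith
  have q2 : X.gromovProd o (g • o) (h⁻¹ • o) ≤ p + δ := by
    by_contra! hc
    obtain ⟨r, hr1, hr2⟩ := exists_between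
      (lt_min hc (by linarith : p + δ < (B - 3 * δ) / 2))
    have := hX.gromovProd_ge (o := o) (x := g • o) (y := h⁻¹ • o) (z := h • o) (r := r)
      (hr2.le.trans (min_le_left _ _)) ((hr2.le.trans (min_le_right _ _)).trans hh1)
    linarith
  set F : ℝ := ((X.dist o ((g * h) • o) : ℕ) : ℝ) with hF
  have hgh : F = X.dist (g⁻¹ • o) (h • o) := by
    rw [hF, dist_smul_left hG g⁻¹, inv_inv, ← mul_smul]
  have hFq : F = A + B - 2 * X.gromovProd o (g⁻¹ • o) (h • o) := by
    rw [hgh]; unfold gromovProd; rw [hinv]; ring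
  have r1 : X.gromovProd o (g • o) ((g * h) • o) = (A + F - B) / 2 := by
    unfold gromovProd
    rw [mul_smul, hG, ← mul_smul]
  have r2 : X.gromovProd o ((g * h)⁻¹ • o) (h⁻¹ • o) = (F + B - A) / 2 := by
    unfold gromovProd
    rw [hinv, hinv, mul_inv_rev, mul_smul h⁻¹ g⁻¹, hG, X.dist_comm (u := g⁻¹ • o), hinv]
  have r3 : X.gromovProd o ((g * h) • o) ((g * h)⁻¹ • o) ≤ p + 3 * δ := by
    by_contra! hc
    obtain ⟨r, hr1, hr2⟩ := exists_between
      (lt_min hc (lt_min (by linarith : p + 3 * δ < A - p - δ)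
        (by linarith : p + 3 * δ < B - p - δ)))
    have l1 := hr2.le.trans (min_le_left _ _)
    have l2 := hr2.le.trans ((min_le_right _ _).trans (min_le_left _ _))
    have l3 := hr2.le.trans ((min_le_right _ _).trans (min_le_right _ _))
    have s1 := hX.gromovProd_ge (o := o) (x := g • o) (y := (g * h) • o) (z := (g * h)⁻¹ • o)
      (r := r) (by rw [r1]; linarith) l1
    have s2 := hX.gromovProd_ge (o := o) (x := g • o) (y := (g * h)⁻¹ • o) (z := h⁻¹ • o)
      (r := r - δ) s1 (by rw [r2]; linarith)
    linarith
  -- The two products for `g * h` conflict: `r3` bounds it by p + 3δ, while `r4`, with the lower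
  -- bound for `F` and `pA`, `pB`, makes it exceed p + 7δ/2.
  have r4 := hself (g * h) (J.mul_mem hg hh)
  rw [gromovProd_comm] at r4
  linarith

/-- If no element of `J` satisfies the criterion for being hyperbolic, then elements of `J`
displace points on the first half of a geodesic from `o` to a point of its orbit
by a bounded amount. -/
theorem dist_smul_le (hX : X.IsGromovHyperbolic δ)
    (hG : ∀ (g : G) (x y : V), X.dist (g • x) (g • y) = X.dist x y)
    (hJ : ∀ f ∈ J, (X.dist o ((f * f) • o) : ℝ) ≤ X.dist o (f • o) + 3 * δ)
    {g h : G} (hg : g ∈ J) (hh : h ∈ J) {m : V}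
    (hm : X.dist o m + X.dist m (h • o) = X.dist o (h • o))
    (hgm : X.dist o (g • o) ≤ 2 * X.dist o m) (hmh : 2 * X.dist o m ≤ X.dist o (h • o)) :
    (X.dist m (g • m) : ℝ) ≤ 16 * δ := by
  have hδ := hX.nonneg
  have hm' : (X.dist o m + X.dist m (h • o) : ℝ) = X.dist o (h • o) := by exact_mod_cast hm
  have hmh' : (2 * X.dist o m : ℝ) ≤ X.dist o (h • o) := by exact_mod_cast hmh
  have hgm' : (X.dist o (g⁻¹ • o) : ℝ) ≤ 2 * X.dist o m := by
    rw [X.dist_comm, dist_smul_left hG, inv_inv]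
    exact_mod_cast hgm
  have hg' := J.inv_mem hg
  set t : ℝ := ((X.dist o m : ℕ) : ℝ) with ht
  have a1 := hX.dist_smul_smul_le hG hJ hg' hh
  have a1' : (X.dist (g⁻¹ • o) (h • o) : ℝ) ≤ X.dist o (h • o) + 6 * δ :=
    a1.trans (by rw [max_eq_right (by linarith)])
  have A : (X.dist m (g⁻¹ • o) : ℝ) ≤ t + 8 * δ := by
    have h1 := hX.2 m (g⁻¹ • o) o (h • o)
    rw [X.dist_comm (u := m) (v := o), X.dist_comm (u := g⁻¹ • o) (v := o)] at h1
    rcases le_max_iff.1 (sub_le_iff_le_add.2 h1) with h1 | h1 <;> linarith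
  have b1 : (X.dist o ((g⁻¹ * h) • o) : ℝ) ≤ X.dist o (h • o) + 6 * δ := by
    have := hX.dist_smul_smul_le hG hJ hg hh
    rw [X.dist_comm (u := o) (v := (g⁻¹ * h) • o), mul_smul, dist_smul_left hG, inv_inv,
      X.dist_comm]
    refine this.trans ?_
    rw [max_eq_right]
    have : X.dist o (g • o) = X.dist o (g⁻¹ • o) := by
      rw [X.dist_comm, dist_smul_left hG]
    rw [this]; linarith
  have b2 : (X.dist ((g⁻¹ * h) • o) (h • o) : ℝ) ≤ X.dist o (h • o) + 12 * δ := by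
    have := hX.dist_smul_smul_le hG hJ (J.mul_mem hg' hh) hh
    have h3 : max (X.dist o ((g⁻¹ * h) • o) : ℝ) (X.dist o (h • o)) ≤
      X.dist o (h • o) + 6 * δ := max_le b1 (by linarith)
    linarith
  have B : (X.dist m ((g⁻¹ * h) • o) : ℝ) ≤ X.dist m (h • o) + 14 * δ := by
    have h1 := hX.2 m ((g⁻¹ * h) • o) o (h • o)
    rw [X.dist_comm (u := m) (v := o), X.dist_comm (u := (g⁻¹ * h) • o) (v := o)] at h1
    rcases le_max_iff.1 (sub_le_iff_le_add.2 h1) with h1 | h1 <;> linarith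
  -- The worse alternative gives 16δ: 14δ from `B` and 2δ from this inequality.
  have h1 := hX.2 m (g • m) o (h • o)
  rw [X.dist_comm (u := m) (v := o), dist_smul_left hG g m o, dist_smul_left hG g m (h • o),
    ← mul_smul] at h1
  rcases le_max_iff.1 (sub_le_iff_le_add.2 h1) with h1 | h1 <;> linarith

end NoHyperbolic

end IsGromovHyperbolic

end Isometries

end SimpleGraph

namespace SimpleGraph

/-! ### Local finiteness -/

section LocallyFinite

variable {V : Type u} {X : SimpleGraph V}

theorem finite_setOf_walk_length_le (hX : ∀ x, {y | X.Adj x y}.Finite) (x : V) (n : ℕ) :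
    {y | ∃ p : X.Walk x y, p.length ≤ n}.Finite := by
  induction n generalizing x with
  | zero =>
    refine (Set.finite_singleton x).subset ?_
    rintro y ⟨p, hp⟩
    exact (Walk.eq_of_length_eq_zero (Nat.le_zero.1 hp)).symm
  | succ n ih =>
    refine ((Set.finite_singleton x).union ((hX x).biUnion fun z _ => ih z)).subset ?_
    rintro y ⟨p, hp⟩
    cases p with
    | nil => exact Or.inl rfl
    | cons h p =>
      refine Or.inr (Set.mem_biUnion h ⟨p, ?_⟩)
      rw [Walk.length_cons] at hp
      omega

theorem finite_setOf_edist_le (hX : ∀ x, {y | X.Adj x y}.Finite) (x : V) (n : ℕ) :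
    {y | X.edist x y ≤ n}.Finite := by
  refine (finite_setOf_walk_length_le hX x n).subset fun y hy => ?_
  obtain ⟨p, hp⟩ := X.exists_walk_of_edist_ne_top (ne_top_of_le_ne_top (ENat.natCast_ne_top n) hy)
  exact ⟨p, by exact_mod_cast hp.trans_le hy⟩

theorem Connected.finite_setOf_dist_le (hc : X.Connected) (hX : ∀ x, {y | X.Adj x y}.Finite)
    (x : V) (n : ℕ) : {y | X.dist x y ≤ n}.Finite := by
  refine (finite_setOf_walk_length_le hX x n).subset fun y hy => ?_
  obtain ⟨p, hp⟩ := hc.exists_walk_length_eq_dist x y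
  exact ⟨p, hp.trans_le hy⟩

theorem finite_setOf_mulCayley_adj {G : Type u} [Group G] {s : Set G} (hs : s.Finite) (x : G) :
    {y | (mulCayley s).Adj x y}.Finite := by
  refine ((hs.image (x * ·)).union (hs.image (x * ·⁻¹))).subset fun y hy => ?_
  obtain ⟨-, g, hg, h | h⟩ := (mulCayley_adj' s x y).1 hy
  · exact Or.inl ⟨g, hg, h⟩
  · exact Or.inr ⟨g, hg, by simp [h]⟩

theorem inv_mul_mem_of_mulCayley_reachable {G : Type u} [Group G] {s : Set G} {P : Subgroup G}
    (hs : s ⊆ P) {x y : G} (h : (mulCayley s).Reachable x y) : x⁻¹ * y ∈ P := by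
  obtain ⟨p⟩ := h
  induction p with
  | nil => simp
  | @cons u v w h p ih =>
    have h1 : u⁻¹ * v ∈ P := by
      obtain ⟨-, g, hg, rfl | rfl⟩ := (mulCayley_adj' s u v).1 h
      · simpa using hs hg
      · simpa using hs hg
    simpa [mul_assoc] using P.mul_mem h1 ih

end LocallyFinite

/-! ### Elements of small displacement -/

section Counting

variable {V : Type u} {X : SimpleGraph V} {δ : ℝ} {G : Type v} [Group G] [MulAction G V]

theorem exists_card_le_of_finite_orbits
    (hG : ∀ (g : G) (x y : V), X.dist (g • x) (g • y) = X.dist x y)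
    (hfree : ∀ (g : G) (x : V), g • x = x → g = 1)
    (hfin : ∀ (x : V) (n : ℕ), {y | X.dist x y ≤ n}.Finite) {T : Set V} {Y : Set V}
    (hY : Y.Finite) (hT : ∀ x ∈ T, ∃ y ∈ Y, ∃ g : G, x = g • y) (K : ℕ) :
    ∃ N : ℕ, ∀ x ∈ T, ∀ F : Finset G, (∀ g ∈ F, X.dist x (g • x) ≤ K) → F.card ≤ N := by
  classical
  refine ⟨hY.toFinset.sup fun y => (hfin y K).toFinset.card, fun x hx F hF => ?_⟩
  obtain ⟨y, hy, k, rfl⟩ := hT x hx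
  refine le_trans ?_ (Finset.le_sup (hY.mem_toFinset.2 hy))
  -- Conjugating by `k` moves the count to the orbit representative `y`; freeness makes it a count
  -- of points in the `K`-ball about `y`.
  refine Finset.card_le_card_of_injOn (fun g => (k⁻¹ * g * k) • y) ?_ ?_
  · intro g hg
    have := hF g hg
    rw [dist_smul_left hG] at this
    simpa [mul_smul] using this
  · intro g _ g' _ h
    have h1 : ((k⁻¹ * g' * k)⁻¹ * (k⁻¹ * g * k)) • y = y := by
      rw [mul_smul]; exact inv_smul_eq_iff.2 h
    have h2 := hfree _ _ h1
    exact (mul_left_cancel (mul_right_cancel (inv_mul_eq_one.1 h2))).symm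

theorem exists_le_dist_smul (hfree : ∀ (g : G) (x : V), g • x = x → g = 1)
    (hfin : ∀ (x : V) (n : ℕ), {y | X.dist x y ≤ n}.Finite) {J : Subgroup G}
    (hJ : (J : Set G).Infinite) (o : V) (n : ℕ) : ∃ h ∈ J, n ≤ X.dist o (h • o) := by
  by_contra! hcon
  refine hJ (Set.Finite.of_finite_image ((hfin o n).subset ?_) (f := fun g => g • o) ?_)
  · rintro _ ⟨g, hg, rfl⟩
    exact (hcon g hg).le
  · intro g _ g' _ h
    have h1 : (g'⁻¹ * g) • o = o := by rw [mul_smul]; exact inv_smul_eq_iff.2 h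
    exact (inv_mul_eq_one.1 (hfree _ _ h1)).symm

/-- Far enough out on the first half of the geodesic, N + 1 chosen elements of J all have
displacement at most 16δ, one more than is possible in `T`. -/
theorem IsGromovHyperbolic.exists_notMem (hX : X.IsGromovHyperbolic δ)
    (hG : ∀ (g : G) (x y : V), X.dist (g • x) (g • y) = X.dist x y) {J : Subgroup G} {o : V}
    (hJ : ∀ f ∈ J, (X.dist o ((f * f) • o) : ℝ) ≤ X.dist o (f • o) + 3 * δ)
    (hJinf : (J : Set G).Infinite) {K N : ℕ} (hK : 16 * δ ≤ K) {T : Set V}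
    (hT : ∀ x ∈ T, ∀ F : Finset G, (∀ g ∈ F, X.dist x (g • x) ≤ K) → F.card ≤ N) :
    ∃ t₀ : ℕ, ∀ h ∈ J, ∀ m, X.dist o m + X.dist m (h • o) = X.dist o (h • o) →
      t₀ ≤ X.dist o m → 2 * X.dist o m ≤ X.dist o (h • o) → m ∉ T := by
  obtain ⟨F, hFJ, hF⟩ := hJinf.exists_subset_card_eq (N + 1)
  -- Beyond the largest displacement of `o` by the chosen elements, `dist_smul_le` applies to all of
  -- them at once.
  refine ⟨F.sup fun g => X.dist o (g • o), fun h hh m hm ht hmh hmT => ?_⟩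
  have := hT m hmT F fun g hg => by
    have h1 : X.dist o (g • o) ≤ F.sup fun g => X.dist o (g • o) :=
      Finset.le_sup (f := fun g => X.dist o (g • o)) hg
    have h2 := hX.dist_smul_le hG hJ (hFJ hg) hh hm (by omega) hmh
    exact_mod_cast h2.trans hK
  omega

theorem Connected.exists_dist_eq (hX : X.Connected) {x y : V} {t : ℕ} (ht : t ≤ X.dist x y) :
    ∃ m, X.dist x m = t ∧ X.dist x m + X.dist m y = X.dist x y := by
  obtain ⟨c, h0, h1, hc⟩ := hX.exists_geodesic x y
  have h2 := hc 0 t (by omega)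
  have h3 := hc t (X.dist x y - t) (by omega)
  rw [Nat.add_sub_cancel' ht, h1] at h3
  rw [zero_add, h0] at h2
  exact ⟨c t, h2, by omega⟩

/-- An infinite group acting freely and cocompactly on a hyperbolic graph contains
an element that satisfies the criterion of `exists_axis`. -/
theorem IsGromovHyperbolic.exists_of_cocompact (hX : X.IsGromovHyperbolic δ)
    (hG : ∀ (g : G) (x y : V), X.dist (g • x) (g • y) = X.dist x y)
    (hfree : ∀ (g : G) (x : V), g • x = x → g = 1)
    (hfin : ∀ (x : V) (n : ℕ), {y | X.dist x y ≤ n}.Finite) {Y : Set V} (hY : Y.Finite)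
    (hcov : ∀ x, ∃ y ∈ Y, ∃ g : G, x = g • y) {J : Subgroup G}
    (hJinf : (J : Set G).Infinite) (o : V) :
    ∃ f ∈ J, (X.dist o (f • o) : ℝ) + 3 * δ < X.dist o ((f * f) • o) := by
  by_contra! hJ
  obtain ⟨N, hN⟩ := exists_card_le_of_finite_orbits (T := Set.univ) hG hfree hfin hY
    (fun x _ => hcov x) ⌈16 * δ⌉₊
  obtain ⟨t, ht⟩ := hX.exists_notMem hG hJ hJinf (Nat.le_ceil _) hN
  obtain ⟨h, hh, hle⟩ := exists_le_dist_smul hfree hfin hJinf o (2 * t)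
  obtain ⟨m, hm, hm'⟩ := hX.1.exists_dist_eq (x := o) (y := h • o) (t := t) (by omega)
  exact ht h hh m hm' hm.ge (by omega) trivial

end Counting

end SimpleGraph

/-! ### Horoballs of the cusped space -/

section CuspedSpace

variable {G : Type u} [Group G] {𝓟 : Set (Subgroup G)} {S : Set G}

namespace CuspedVertex

def depth : CuspedVertex 𝓟 → ℕ
  | base _ => 0
  | horo _ _ k => k + 1

@[simp] theorem depth_pt (P : 𝓟) (g : G) (k : ℕ) : (pt P g k).depth = k := by
  cases k <;> rfl

theorem smul_base (x g : G) : x • (base g : CuspedVertex 𝓟) = base (x * g) := rfl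

theorem smul_horo (x : G) (P : 𝓟) (g : G) (k : ℕ) : x • horo P g k = horo P (x * g) k := rfl

theorem smul_pt (x : G) (P : 𝓟) (g : G) (k : ℕ) : x • pt P g k = pt P (x * g) k := by
  cases k <;> rfl

/-- Two vertices of positive depth lie in the same horoball. -/
def SameHoroball (v w : CuspedVertex 𝓟) : Prop :=
  ∃ (P : 𝓟) (g g' : G) (k k' : ℕ), v = horo P g k ∧ w = horo P g' k' ∧ g⁻¹ * g' ∈ P.1

theorem SameHoroball.refl {v : CuspedVertex 𝓟} (h : 0 < v.depth) : SameHoroball v v := by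
  cases v with
  | base g => simp [depth] at h
  | horo P g k => exact ⟨P, g, g, k, k, rfl, rfl, by simp⟩

theorem SameHoroball.symm {v w : CuspedVertex 𝓟} (h : SameHoroball v w) : SameHoroball w v := by
  obtain ⟨P, g, g', k, k', rfl, rfl, h⟩ := h
  exact ⟨P, g', g, k', k, rfl, rfl, by simpa using P.1.inv_mem h⟩

theorem SameHoroball.trans {v w z : CuspedVertex 𝓟} (h : SameHoroball v w)
    (h' : SameHoroball w z) : SameHoroball v z := by
  obtain ⟨P, g, g', k, k', rfl, rfl, h⟩ := h
  obtain ⟨P', g₁, g₂, k₁, k₂, e, rfl, h'⟩ := h'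
  obtain ⟨rfl, rfl, rfl⟩ := CuspedVertex.horo.inj e
  exact ⟨P, g, g₂, k, k₂, rfl, rfl, by simpa [mul_assoc] using P.1.mul_mem h h'⟩

theorem SameHoroball.smul {v w : CuspedVertex 𝓟} (h : SameHoroball v w) (x : G) :
    SameHoroball (x • v) (x • w) := by
  obtain ⟨P, g, g', k, k', rfl, rfl, h⟩ := h
  exact ⟨P, x * g, x * g', k, k', rfl, rfl, by simpa [mul_assoc] using h⟩

end CuspedVertex

open CuspedVertex

/-- Turns the indices into equations, since `pt P g k` is a function value rather than a constructor
and is awkward to unify with a given vertex. -/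
theorem CuspedRel.cases {v w : CuspedVertex 𝓟} (h : CuspedRel 𝓟 S v w) :
    (∃ g, ∃ s ∈ S, v = base g ∧ w = base (g * s)) ∨
    (∃ P g k, v = pt P g k ∧ w = pt P g (k + 1)) ∨
    ∃ P g g' k, v = horo P g k ∧ w = horo P g' k ∧
      (SimpleGraph.mulCayley (S ∩ P.1 : Set G)).edist g g' ≤ 2 ^ (k + 1) := by
  cases h with
  | cayley g s hs => exact Or.inl ⟨g, s, hs, rfl, rfl⟩
  | vertical P g k => exact Or.inr (Or.inl ⟨P, g, k, rfl, rfl⟩)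
  | horizontal P g g' k h => exact Or.inr (Or.inr ⟨P, g, g', k, rfl, rfl, h⟩)

theorem CuspedRel.depth_le {v w : CuspedVertex 𝓟} (h : CuspedRel 𝓟 S v w) :
    v.depth ≤ w.depth + 1 ∧ w.depth ≤ v.depth + 1 := by
  obtain ⟨g, s, -, rfl, rfl⟩ | ⟨P, g, k, rfl, rfl⟩ | ⟨P, g, g', k, rfl, rfl, -⟩ := h.cases
  · simp [depth]
  · simp; omega
  · simp [depth]

theorem CuspedRel.sameHoroball {v w : CuspedVertex 𝓟} (h : CuspedRel 𝓟 S v w)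
    (hv : 0 < v.depth) : SameHoroball v w := by
  obtain ⟨g, s, -, rfl, rfl⟩ | ⟨P, g, k, rfl, rfl⟩ | ⟨P, g, g', k, rfl, rfl, hle⟩ := h.cases
  · simp [depth] at hv
  · cases k with
    | zero => simp at hv
    | succ k => exact ⟨P, g, g, k, k + 1, rfl, rfl, by simp⟩
  · refine ⟨P, g, g', k, k, rfl, rfl, SimpleGraph.inv_mul_mem_of_mulCayley_reachable
      (s := S ∩ P.1) Set.inter_subset_right (SimpleGraph.reachable_of_edist_ne_top
        (ne_top_of_le_ne_top ?_ hle))⟩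
    exact_mod_cast ENat.natCast_ne_top (2 ^ (k + 1))

theorem cuspedGraph_adj_depth {v w : CuspedVertex 𝓟} (h : (cuspedGraph 𝓟 S).Adj v w) :
    v.depth ≤ w.depth + 1 :=
  h.2.elim (fun h => h.depth_le.1) fun h => h.depth_le.2

theorem cuspedGraph_adj_sameHoroball {v w : CuspedVertex 𝓟} (h : (cuspedGraph 𝓟 S).Adj v w)
    (hv : 0 < v.depth) (hw : 0 < w.depth) : SameHoroball v w :=
  h.2.elim (fun h => h.sameHoroball hv) fun h => (h.sameHoroball hw).symm

/-- Depth changes by at most one along an edge, so the walk is too short to reach depth 0, and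
adjacent vertices of positive depth share a horoball. -/
theorem sameHoroball_of_walk {v w : CuspedVertex 𝓟} (p : (cuspedGraph 𝓟 S).Walk v w)
    (h : p.length < v.depth) : SameHoroball v w := by
  induction p with
  | nil => exact SameHoroball.refl (by omega)
  | cons hadj p ih =>
    rw [SimpleGraph.Walk.length_cons] at h
    have h1 := cuspedGraph_adj_depth hadj
    exact (cuspedGraph_adj_sameHoroball hadj (by omega) (by omega)).trans (ih (by omega))

theorem finite_setOf_cuspedGraph_adj (h𝓟 : 𝓟.Finite) (hS : S.Finite) (v : CuspedVertex 𝓟) :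
    {w | (cuspedGraph 𝓟 S).Adj v w}.Finite := by
  have : Finite 𝓟 := h𝓟
  cases v with
  | base g =>
    refine (((hS.image fun s => base (g * s)).union (hS.image fun s => base (g * s⁻¹))).union
      (Set.finite_range fun P : 𝓟 => horo P g 0)).subset ?_
    rintro w ⟨-, h | h⟩
    · obtain ⟨g', s, hs, e, rfl⟩ | ⟨P, g', k, e, rfl⟩ | ⟨P, g', g'', k, e, rfl, -⟩ := h.cases
      · obtain rfl := CuspedVertex.base.inj e
        exact Or.inl (Or.inl ⟨s, hs, rfl⟩)
      · cases k with
        | zero =>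
          obtain rfl := CuspedVertex.base.inj e
          exact Or.inr ⟨P, rfl⟩
        | succ k => cases e
      · cases e
    · obtain ⟨g', s, hs, rfl, e⟩ | ⟨P, g', k, rfl, e⟩ | ⟨P, g', g'', k, rfl, e, -⟩ := h.cases
      · obtain rfl := CuspedVertex.base.inj e
        exact Or.inl (Or.inr ⟨s, hs, by simp⟩)
      · cases e
      · cases e
  | horo P g k =>
    have hball : {g' | (SimpleGraph.mulCayley (S ∩ P.1 : Set G)).edist g g' ≤ 2 ^ (k + 1)}.Finite := by
      have := SimpleGraph.finite_setOf_edist_le (SimpleGraph.finite_setOf_mulCayley_adj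
        (hS.subset (Set.inter_subset_left (t := (P.1 : Set G))))) g (2 ^ (k + 1))
      exact_mod_cast this
    refine (((Set.finite_singleton (horo P g (k + 1))).union
      (Set.finite_singleton (pt P g k))).union (hball.image fun g' => horo P g' k)).subset ?_
    rintro w ⟨-, h | h⟩
    · obtain ⟨g', s, hs, e, rfl⟩ | ⟨P', g', k', e, rfl⟩ | ⟨P', g', g'', k', e, rfl, h⟩ := h.cases
      · cases e
      · cases k' with
        | zero => cases e
        | succ k' =>
          obtain ⟨rfl, rfl, rfl⟩ := CuspedVertex.horo.inj e
          exact Or.inl (Or.inl rfl)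
      · obtain ⟨rfl, rfl, rfl⟩ := CuspedVertex.horo.inj e
        exact Or.inr ⟨g'', h, rfl⟩
    · obtain ⟨g', s, hs, rfl, e⟩ | ⟨P', g', k', rfl, e⟩ | ⟨P', g', g'', k', rfl, e, h⟩ := h.cases
      · cases e
      · obtain ⟨rfl, rfl, rfl⟩ := CuspedVertex.horo.inj e
        exact Or.inl (Or.inr rfl)
      · obtain ⟨rfl, rfl, rfl⟩ := CuspedVertex.horo.inj e
        exact Or.inr ⟨g', by rw [SimpleGraph.edist_comm] at h; exact h, rfl⟩

theorem cuspedGraph_dist_smul (g : G) (x y : CuspedVertex 𝓟) :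
    (cuspedGraph 𝓟 S).dist (g • x) (g • y) = (cuspedGraph 𝓟 S).dist x y := by
  have key : ∀ (g : G) x y,
      (cuspedGraph 𝓟 S).edist (g • x) (g • y) ≤ (cuspedGraph 𝓟 S).edist x y := fun g x y =>
    SimpleGraph.Hom.edist_le (X := cuspedGraph 𝓟 S) ⟨fun v => g • v, cuspedGraph_adj_smul g⟩ x y
  have h := key g⁻¹ (g • x) (g • y)
  rw [inv_smul_smul, inv_smul_smul] at h
  rw [SimpleGraph.dist, SimpleGraph.dist, le_antisymm (key g x y) h]

theorem CuspedVertex.eq_one_of_smul_eq (g : G) (x : CuspedVertex 𝓟) (h : g • x = x) : g = 1 :=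
  (inferInstance : SGraph.FreeAction G (freeCuspedGraph 𝓟 ∅)).free g x h

/-- An infinite subgroup of `G` none of whose elements satisfies the criterion of
`exists_axis` preserves a horoball of the cusped space. -/
theorem exists_horoball_of_noHyperbolic {δ : ℝ} (h𝓟 : 𝓟.Finite) (hS : S.Finite)
    (hX : (cuspedGraph 𝓟 S).IsGromovHyperbolic δ) {J : Subgroup G} (hJinf : (J : Set G).Infinite)
    {o : CuspedVertex 𝓟}
    (hJ : ∀ f ∈ J, ((cuspedGraph 𝓟 S).dist o ((f * f) • o) : ℝ) ≤
      (cuspedGraph 𝓟 S).dist o (f • o) + 3 * δ) :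
    ∃ (P : 𝓟) (t : G), ∀ g ∈ J, t⁻¹ * g * t ∈ P.1 := by
  have : Finite 𝓟 := h𝓟
  set X := cuspedGraph 𝓟 S
  have hG : ∀ (g : G) (x y : CuspedVertex 𝓟), X.dist (g • x) (g • y) = X.dist x y :=
    cuspedGraph_dist_smul
  have hfree : ∀ (g : G) (x : CuspedVertex 𝓟), g • x = x → g = 1 :=
    CuspedVertex.eq_one_of_smul_eq
  have hfin := hX.1.finite_setOf_dist_le (finite_setOf_cuspedGraph_adj h𝓟 hS)
  set K := ⌈16 * δ⌉₊
  have hK : 16 * δ ≤ K := Nat.le_ceil _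
  let Y : Set (CuspedVertex 𝓟) :=
    {base 1} ∪ Set.range fun q : 𝓟 × Fin (K + 1) => horo q.1 1 q.2
  -- The part of depth at most `K` is cocompact, with orbit representatives over the identity;
  -- points that avoid it are deeper than any displacement bounded by 16δ.
  obtain ⟨N, hN⟩ := SimpleGraph.exists_card_le_of_finite_orbits (X := X) (Y := Y)
    (T := {v | v.depth ≤ K}) hG hfree hfin
    ((Set.finite_singleton _).union (Set.finite_range _)) (by
      rintro (g | ⟨P, g, k⟩) hv
      · exact ⟨base 1, Or.inl rfl, g, by rw [smul_base, mul_one]⟩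
      · have hk : k + 1 ≤ K := hv
        exact ⟨horo P 1 k, Or.inr ⟨(P, ⟨k, by omega⟩), rfl⟩, g, by rw [smul_horo, mul_one]⟩) K
  obtain ⟨t, ht⟩ := hX.exists_notMem hG hJ hJinf hK hN
  have hstep : ∀ n : ℕ, ∃ v, X.dist o v ≤ t ∧ ∀ g ∈ J, X.dist o (g • o) ≤ 2 * n →
      SameHoroball v (g • v) := by
    intro n
    -- The length 2(t + n) puts c(t), …, c(t + n) in the first half of the geodesic. They are all
    -- deeper than `K`, hence in one horoball.
    obtain ⟨h, hh, hle⟩ := SimpleGraph.exists_le_dist_smul hfree hfin hJinf o (2 * (t + n))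
    obtain ⟨c, h0, h1, hc⟩ := hX.1.exists_geodesic o (h • o)
    have hco : ∀ i, i ≤ X.dist o (h • o) → X.dist o (c i) = i := fun i hi => by
      have := hc 0 i (by omega)
      rwa [zero_add, h0] at this
    have hch : ∀ i, i ≤ X.dist o (h • o) →
        X.dist o (c i) + X.dist (c i) (h • o) = X.dist o (h • o) := fun i hi => by
      have h2 := hc i (X.dist o (h • o) - i) (by omega)
      rw [Nat.add_sub_cancel' hi, h1] at h2
      have := hco i hi
      omega
    have hdeep : ∀ i, t ≤ i → i ≤ t + n → K < (c i).depth := fun i hi hi' => by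
      have h2 := hco i (by omega)
      have := ht h hh (c i) (hch i (by omega)) (by omega) (by omega)
      exact not_le.1 this
    have hsame : ∀ i, i ≤ n → SameHoroball (c t) (c (t + i)) := by
      intro i
      induction i with
      | zero =>
        intro _
        have := hdeep t le_rfl (by omega)
        exact SameHoroball.refl (by omega)
      | succ i ih =>
        intro hi
        have h2 := hdeep (t + i) (by omega) (by omega)
        have h3 := hdeep (t + (i + 1)) (by omega) (by omega)
        exact (ih (by omega)).trans (cuspedGraph_adj_sameHoroball
          (SimpleGraph.dist_eq_one_iff_adj.1 (hc (t + i) 1 (by omega))) (by omega) (by omega))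
    refine ⟨c t, (hco t (by omega)).le, fun g hg hgn => ?_⟩
    have h2 := hco (t + n) (by omega)
    have h3 := hX.dist_smul_le hG hJ hg hh (hch (t + n) (by omega)) (by omega) (by omega)
    have h4 : X.dist (c (t + n)) (g • c (t + n)) ≤ K := by exact_mod_cast h3.trans hK
    obtain ⟨p, hp⟩ := hX.1.exists_walk_length_eq_dist (c (t + n)) (g • c (t + n))
    -- `g` moves c(t + n) by at most `K`, less than its depth, so `g` preserves its horoball, which
    -- is also that of c(t).
    have h5 := sameHoroball_of_walk p
      ((hp.trans_le h4).trans_lt (hdeep (t + n) (by omega) le_rfl))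
    have h6 := hsame n le_rfl
    exact (h6.trans h5).trans (h6.smul g).symm
  choose v hvt hv using hstep
  have : Finite {w | X.dist o w ≤ t} := hfin o t
  -- The vertices v_n lie in a finite ball independent of `n`; one that occurs for infinitely many
  -- `n` serves every element of J.
  obtain ⟨⟨w, hw⟩, hwinf⟩ := Finite.exists_infinite_fiber
    (fun n => (⟨v n, hvt n⟩ : {w | X.dist o w ≤ t}))
  have hall : ∀ g ∈ J, SameHoroball w (g • w) := fun g hg => by
    obtain ⟨n, hn, hgn⟩ := (Set.infinite_coe_iff.1 hwinf).exists_gt (X.dist o (g • o))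
    have e : v n = w := congrArg Subtype.val (Set.mem_singleton_iff.1 hn)
    rw [← e]
    exact hv n g hg (by omega)
  obtain ⟨P, g₁, -, k, -, rfl, -, -⟩ := hall 1 J.one_mem
  refine ⟨P, g₁, fun g hg => ?_⟩
  obtain ⟨P', a, b, k₁, k₂, e₁, e₂, h⟩ := hall g hg
  obtain ⟨rfl, rfl, rfl⟩ := CuspedVertex.horo.inj e₁
  obtain ⟨-, rfl, -⟩ := CuspedVertex.horo.inj e₂
  simpa [mul_assoc] using h

end CuspedSpace

/-! ### Paths within a set of edges -/

namespace SGraph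

/-- `a` and `b` are joined by an edge path whose edges lie in `S`. -/
def Joined (X : SGraph.{u}) (S : Set X.E) (a b : X.V) : Prop :=
  ∃ l, X.IsPath a l b ∧ ∀ e ∈ l, e ∈ S

section Joined

variable {X : SGraph.{u}} {S : Set X.E} {a b c : X.V}

theorem Joined.refl (a : X.V) : X.Joined S a a := ⟨[], rfl, by simp⟩

theorem Joined.trans (h : X.Joined S a b) (h' : X.Joined S b c) : X.Joined S a c := by
  obtain ⟨l, hl, hS⟩ := h
  obtain ⟨l', hl', hS'⟩ := h'
  refine ⟨l ++ l', (X.isPath_append _ _ _ _).2 ⟨b, hl, hl'⟩, fun e he => ?_⟩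
  exact (List.mem_append.1 he).elim (hS e) (hS' e)

theorem Joined.symm (hrev : ∀ e ∈ S, X.rev e ∈ S) (h : X.Joined S a b) : X.Joined S b a := by
  obtain ⟨l, hl, hS⟩ := h
  refine ⟨X.revPath l, X.isPath_revPath _ _ _ hl, fun e he => ?_⟩
  obtain ⟨e', he', rfl⟩ := List.mem_map.1 (List.mem_reverse.1 he)
  exact hrev _ (hS _ he')

theorem Joined.edge {e : X.E} (he : e ∈ S) : X.Joined S (X.src e) (X.tgt e) :=
  ⟨[e], ⟨rfl, rfl⟩, by simpa using he⟩

theorem exists_edge_of_adj (h : X.simple.Adj a b) : ∃ e, X.src e = a ∧ X.tgt e = b := by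
  obtain ⟨-, h | ⟨e, h1, h2⟩⟩ := h
  · exact h
  · exact ⟨X.rev e, h2, by rw [tgt, X.rev_rev, h1]⟩

theorem Joined.of_adj (h : X.simple.Adj a b) (hS : ∀ e, X.src e = a → e ∈ S) :
    X.Joined S a b := by
  obtain ⟨e, rfl, rfl⟩ := exists_edge_of_adj h
  exact Joined.edge (hS e rfl)

/-- Points at distance `≤ r` are joined in the set of edges issuing from the `r`-ball. -/
theorem Joined.of_dist_le (hc : X.simple.Connected) {r : ℕ} (hr : X.simple.dist a b ≤ r)
    (hS : ∀ e, X.simple.dist a (X.src e) ≤ r → e ∈ S) : X.Joined S a b := by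
  obtain ⟨c, h0, h1, hc⟩ := hc.exists_geodesic a b
  have key : ∀ i, i ≤ X.simple.dist a b → X.Joined S a (c i) := by
    intro i
    induction i with
    | zero => intro _; rw [h0]; exact Joined.refl a
    | succ i ih =>
      intro hi
      refine (ih (by omega)).trans (Joined.of_adj
        (SimpleGraph.dist_eq_one_iff_adj.1 (hc i 1 hi)) fun e he => hS e ?_)
      have := hc 0 i (by omega)
      rw [zero_add, h0] at this
      rw [he]; omega
  rw [← h1]
  exact key _ le_rfl

end Joined

section Action

variable {K : Type v} [Group K] {X : SGraph.{u}} [FreeAction K X]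

theorem dist_smul (k : K) (a b : X.V) :
    X.simple.dist (k • a) (k • b) = X.simple.dist a b := by
  rw [SimpleGraph.dist, SimpleGraph.dist, edist_smul]

theorem finite_setOf_adj [Finite (X.quotient K).E] (a : X.V) :
    {b | X.simple.Adj a b}.Finite := by
  have hE : {e | X.src e = a}.Finite := by
    refine Set.Finite.of_finite_image (f := (X.proj K).onE) (Set.toFinite _) ?_
    intro e he e' he' h
    obtain ⟨k, hk⟩ := (X.proj_onE_eq K).1 h
    exact (FreeAction.edge_eq hk (he'.trans he.symm)).symm
  refine (hE.image X.tgt).subset fun b hb => ?_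
  obtain ⟨e, h1, h2⟩ := exists_edge_of_adj hb
  exact ⟨e, h1, h2⟩

end Action

end SGraph

/-! ### Intersections containing an element with an axis -/

namespace AmbientGraph

variable {G : Type u} [Group G] {A : AmbientGraph G} {H : Subgroup G} {δ : ℝ}

open SGraph

/-- If k_m o converges to the end of `s`, then g⁻¹k_m o converges to the end of the translated ray,
and the H-orbit points (g⁻¹ k_m g) o stay at constant distance from it. -/
theorem mem_limitSet (hX : A.graph.simple.IsGromovHyperbolic δ) {g : G} {k : ℕ → G}
    (hk : ∀ m, g⁻¹ * k m * g ∈ H) {s : ℕ → A.graph.V}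
    (hs : ∀ M : ℝ, ∃ n₀ : ℕ, ∀ m ≥ n₀, ∀ N ≥ n₀,
      M ≤ A.graph.simple.gromovProd A.base (k m • A.base) (s N))
    (γ : A.graph.simple.GeodesicRay) (hγ : ∀ n, γ.1 n = g⁻¹ • s n) :
    (Quotient.mk _ γ : A.graph.simple.GromovBoundary) ∈ A.limitSet H := by
  refine ⟨γ, fun m => ⟨_, hk m⟩, rfl, Filter.tendsto_atTop.2 fun M => ?_⟩
  set L : ℝ := ((A.graph.simple.dist A.base (g⁻¹ • A.base) : ℕ) : ℝ) with hL
  -- One L is for returning the base point from g⁻¹ o to o, the other for replacing g⁻¹k_m o by the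
  -- orbit point.
  obtain ⟨n₀, hn₀⟩ := hs (M + 2 * L)
  filter_upwards [Filter.eventually_ge_atTop (n₀, n₀)] with p hp
  have h1 := hn₀ p.1 hp.1 p.2 hp.2
  rw [← SimpleGraph.gromovProd_smul (X := A.graph.simple) (G := G) SGraph.dist_smul g⁻¹] at h1
  have h2 := hX.gromovProd_base (g⁻¹ • A.base) A.base (g⁻¹ • k p.1 • A.base) (g⁻¹ • s p.2)
  have h3 := hX.gromovProd_right A.base (g⁻¹ • s p.2) (g⁻¹ • k p.1 • A.base)
    ((g⁻¹ * k p.1 * g) • A.base)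
  have h4 : A.graph.simple.dist (g⁻¹ • k p.1 • A.base) ((g⁻¹ * k p.1 * g) • A.base) =
      A.graph.simple.dist A.base (g⁻¹ • A.base) := by
    rw [mul_smul, mul_smul, SGraph.dist_smul, SGraph.dist_smul, SimpleGraph.dist_comm,
      SimpleGraph.dist_smul_left (X := A.graph.simple) (G := G) SGraph.dist_smul]
  rw [h4, ← hL] at h3
  rw [SimpleGraph.dist_comm, ← hL] at h2
  rw [SimpleGraph.gromovProd_comm A.base (g⁻¹ • k p.1 • A.base)] at h2
  change M ≤ A.graph.simple.gromovProd A.base ((g⁻¹ * k p.1 * g) • A.base) (γ.1 p.2)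
  rw [hγ, SimpleGraph.gromovProd_comm]
  linarith

variable {R : ℝ} {Z : InvSubgraph H A.graph} {b : Z.graph.V}
  {σ : ∀ z : (Z.graph.quotient H).V,
    {l // (Z.graph.quotient H).IsPath ((Z.graph.proj H).onV b) l z}}

/-- All g_i⁻¹γ, for an axis γ of `f`, join limit points of H, so every translate g_i Z̃ contains the
edges issuing from the open R-neighbourhood of γ. These connect γ(0) to every f^m γ(0). -/
theorem exists_multiplicity_of_hyperbolic (hX : A.graph.simple.IsGromovHyperbolic δ)
    (hfin : ∀ (x : A.graph.V) (n : ℕ), {y | A.graph.simple.dist x y ≤ n}.Finite)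
    (hR : 4 * δ + 1 < R)
    (hZ : ∀ γ : A.GeodesicLine,
      Quotient.mk _ γ.pos ∈ A.limitSet H → Quotient.mk _ γ.neg ∈ A.limitSet H →
      ∀ e n, (A.graph.simple.dist (A.graph.src e) (γ.vert n) : ℝ) < R → e ∈ Z.edges)
    {n : ℕ} [NeZero n] {g : Fin n → G} (hg : Function.Injective (fun i => (g i : G ⧸ H)))
    {f : G} (hfH : ∀ i, (g i)⁻¹ * f * g i ∈ H)
    (hf : (A.graph.simple.dist A.base (f • A.base) : ℝ) + 3 * δ <
      A.graph.simple.dist A.base ((f * f) • A.base)) :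
    ∃ p : (Z.pullback n).V, ∀ i, ((Z.tau b σ n p i).range : Set H).Infinite := by
  have hG := SGraph.dist_smul (K := G) (X := A.graph)
  obtain ⟨hinj, γ, hγ, hlim⟩ := hX.exists_axis hG hfin hf
  have hpow : ∀ (m : ℕ) i, (g i)⁻¹ * f ^ m * g i ∈ H := fun m i => by
    have := H.pow_mem (hfH i) m
    rwa [show (g i)⁻¹ * f * g i = (g i)⁻¹ * f * (g i)⁻¹⁻¹ by rw [inv_inv], conj_pow,
      inv_inv] at this
  have hδ := hX.nonneg
  have hadj : ∀ m : ℤ, A.graph.simple.Adj (γ m) (γ (m + 1)) := fun m =>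
    SimpleGraph.dist_eq_one_iff_adj.1 (by exact_mod_cast hγ m 1)
  choose ε hε₁ hε₂ using fun m => exists_edge_of_adj (hadj m)
  let line : Fin n → A.GeodesicLine := fun i =>
    { vert := fun m => (g i)⁻¹ • γ m
      edge := fun m => (g i)⁻¹ • ε m
      src_edge := fun m => by rw [FreeAction.src_smul, hε₁]
      tgt_edge := fun m => by
        rw [tgt, FreeAction.rev_smul, FreeAction.src_smul]; exact congrArg _ (hε₂ m)
      geodesic := fun m k => by rw [hG, hγ] }
  let S : Set A.graph.E := {e | ∀ i, (g i)⁻¹ • e ∈ Z.edges}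
  have hSrev : ∀ e ∈ S, A.graph.rev e ∈ S := fun e he i => by
    rw [← FreeAction.rev_smul]; exact Z.rev_mem _ (he i)
  have hS : ∀ e m, (A.graph.simple.dist (A.graph.src e) (γ m) : ℝ) < R → e ∈ S := by
    intro e m hem i
    refine hZ (line i) ?_ ?_ ((g i)⁻¹ • e) m ?_
    · refine mem_limitSet hX (k := fun m => f ^ m) (fun m => hpow m i)
        (s := fun N => γ N) (fun M => ?_) _ fun _ => rfl
      obtain ⟨n₀, h⟩ := hlim M
      exact ⟨n₀, fun m hm N hN => (h m hm N hN).1⟩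
    · refine mem_limitSet hX (k := fun m => (f ^ m)⁻¹) (fun m => ?_)
        (s := fun N => γ (-N)) (fun M => ?_) _ fun _ => rfl
      · have := H.inv_mem (hpow m i)
        simpa [mul_assoc] using this
      · obtain ⟨n₀, h⟩ := hlim M
        exact ⟨n₀, fun m hm N hN => (h m hm N hN).2⟩
    · change (A.graph.simple.dist (A.graph.src ((g i)⁻¹ • e)) ((g i)⁻¹ • γ m) : ℝ) < R
      rw [FreeAction.src_smul, hG]
      exact hem
  have hline : ∀ m : ℤ, A.graph.Joined S (γ 0) (γ m) := by
    have hstep : ∀ m : ℤ, A.graph.Joined S (γ m) (γ (m + 1)) := fun m =>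
      Joined.of_adj (hadj m) fun e he => hS e m (by
        rw [he, SimpleGraph.dist_self, Nat.cast_zero]; linarith)
    intro m
    induction m using Int.induction_on with
    | zero => exact SGraph.Joined.refl _
    | succ m ih => exact ih.trans (hstep m)
    | pred m ih =>
      have := hstep (-m - 1)
      rw [sub_add_cancel] at this
      exact ih.trans (this.symm hSrev)
  have h0 : ε 0 ∈ S := hS _ 0 (by
    rw [hε₁, SimpleGraph.dist_self, Nat.cast_zero]; linarith)
  refine Z.exists_multiplicity_of_paths hg (x := γ 0) (J := Set.range fun m : ℕ => f ^ m)
    (fun i => ?_) (Set.infinite_range_of_injective hinj) ?_ ?_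
  · rw [← hε₁ 0, ← FreeAction.src_smul]
    exact Z.src_mem _ (h0 i)
  · rintro _ ⟨m, rfl⟩ i
    exact hpow m i
  · rintro _ ⟨m, rfl⟩
    obtain ⟨N, hN⟩ := hX.exists_near_axis hG hγ hlim m
    -- A geodesic from γ(N) to f^m γ(0) has length at most 4δ + 1 < R, so all its edges issue from
    -- points within R of γ(N).
    refine (hline N).trans (Joined.of_dist_le hX.1 le_rfl fun e he => hS e N ?_)
    rw [SimpleGraph.dist_comm] at hN
    rw [SimpleGraph.dist_comm]
    have : (A.graph.simple.dist (γ N) (A.graph.src e) : ℝ) ≤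
      A.graph.simple.dist (γ N) (f ^ m • γ 0) := by exact_mod_cast he
    linarith

end AmbientGraph

/-! ### Intersections preserving a horoball -/

section Cusped

open SGraph CuspedVertex

variable {G : Type u} [Group G] {𝓟 : Set (Subgroup G)} {S : Set G}

theorem simple_freeCuspedGraph : (freeCuspedGraph 𝓟 S).simple = cuspedGraph 𝓟 S := by
  ext a b
  constructor
  · intro h
    obtain ⟨⟨⟨⟨v, w⟩, β⟩, hvw⟩, rfl, rfl⟩ := exists_edge_of_adj h
    cases β
    · exact hvw.symm
    · exact hvw
  · intro h
    exact ⟨h.1, Or.inl ⟨⟨((a, b), true), h⟩, rfl, rfl⟩⟩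

/-- The vertices of depth at least `n` in the horoball of the coset `t P`. -/
def horoballVerts (P : 𝓟) (t : G) (n : ℕ) : Set (CuspedVertex 𝓟) :=
  {v | ∃ p ∈ P.1, ∃ k, n ≤ k ∧ v = pt P (t * p) k}

theorem smul_mem_horoballVerts {P : 𝓟} {t : G} {n : ℕ} {v : CuspedVertex 𝓟}
    (h : v ∈ horoballVerts P t n) (g : G) : g • v ∈ horoballVerts P (g * t) n := by
  obtain ⟨p, hp, k, hk, rfl⟩ := h
  exact ⟨p, hp, k, hk, by rw [smul_pt, mul_assoc]⟩

theorem horoballVerts_anti {P : 𝓟} {t : G} {m n : ℕ} (h : m ≤ n) :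
    horoballVerts P t n ⊆ horoballVerts P t m := by
  rintro _ ⟨p, hp, k, hk, rfl⟩
  exact ⟨p, hp, k, h.trans hk, rfl⟩

theorem horoballVerts_congr {P : 𝓟} {t t' : G} (h : t⁻¹ * t' ∈ P.1) (n : ℕ) :
    horoballVerts P t' n ⊆ horoballVerts P t n := by
  rintro _ ⟨p, hp, k, hk, rfl⟩
  exact ⟨t⁻¹ * t' * p, P.1.mul_mem h hp, k, hk, by group⟩

theorem image_smul_horoballVerts {P : 𝓟} {t g : G} (h : t⁻¹ * g * t ∈ P.1) (n : ℕ) :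
    (fun v => g • v) '' horoballVerts P t n = horoballVerts P t n := by
  have key : ∀ g : G, t⁻¹ * g * t ∈ P.1 → ∀ v ∈ horoballVerts P t n,
      g • v ∈ horoballVerts P t n := fun g hg v hv =>
    horoballVerts_congr (by rwa [← mul_assoc]) n (smul_mem_horoballVerts hv g)
  refine Set.Subset.antisymm (Set.image_subset_iff.2 (key g h)) fun v hv => ?_
  refine ⟨g⁻¹ • v, key g⁻¹ ?_ v hv, smul_inv_smul g v⟩
  simpa [mul_assoc] using P.1.inv_mem h

/-- Each level of positive depth of a horoball is connected. -/
theorem joined_horoball (hS : IsCompatibleGenSet 𝓟 S) (P : 𝓟) (t : G) (n : ℕ)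
    {E : Set (freeCuspedGraph 𝓟 S).E} (hrev : ∀ e ∈ E, (freeCuspedGraph 𝓟 S).rev e ∈ E)
    (hE : ∀ e, (freeCuspedGraph 𝓟 S).src e ∈ horoballVerts P t (n + 1) →
      (freeCuspedGraph 𝓟 S).tgt e ∈ horoballVerts P t (n + 1) → e ∈ E)
    {p : G} (hp : p ∈ P.1) :
    (freeCuspedGraph 𝓟 S).Joined E (horo P t n) (horo P (t * p) n) := by
  -- The starting point `q` is kept general so that paths for successive generators can be
  -- concatenated; each generator is a horizontal edge, as 1 ≤ 2^(n+1).
  have key : ∀ p ∈ Subgroup.closure (S ∩ P.1), ∀ q ∈ P.1,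
      (freeCuspedGraph 𝓟 S).Joined E (horo P (t * q) n) (horo P (t * q * p) n) := by
    intro p hp
    induction hp using Subgroup.closure_induction with
    | mem s hs =>
      intro q hq
      by_cases h1 : s = 1
      · rw [h1, mul_one]; exact SGraph.Joined.refl _
      · have hne : t * q ≠ t * q * s := fun h => h1 (left_eq_mul.1 h)
        have hadj : (cuspedGraph 𝓟 S).Adj (horo P (t * q) n) (horo P (t * q * s) n) := by
          refine ⟨fun h => hne (CuspedVertex.horo.inj h).2.1,
            Or.inl (CuspedRel.horizontal P _ _ n ?_)⟩
          rw [SimpleGraph.edist_eq_one_iff_adj.2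
            ((SimpleGraph.mulCayley_adj' _ _ _).2 ⟨hne, s, hs, Or.inl rfl⟩)]
          exact_mod_cast Nat.one_le_two_pow
        let e : (freeCuspedGraph 𝓟 S).E := ⟨((horo P (t * q) n, horo P (t * q * s) n), true), hadj⟩
        exact Joined.edge (e := e) (hE e ⟨q, hq, n + 1, le_rfl, rfl⟩
          ⟨q * s, P.1.mul_mem hq hs.2, n + 1, le_rfl, by rw [← mul_assoc]; rfl⟩)
    | one => intro q _; rw [mul_one]; exact SGraph.Joined.refl _
    | mul x y hx hy ihx ihy =>
      intro q hq
      have hx' : x ∈ P.1 := by rwa [hS.closure_inter P.1 P.2] at hx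
      have := ihy (q * x) (P.1.mul_mem hq hx')
      rw [← mul_assoc t] at this
      rw [← mul_assoc]
      exact (ihx q hq).trans this
    | inv x hx ih =>
      intro q hq
      have hx' : x ∈ P.1 := by rwa [hS.closure_inter P.1 P.2] at hx
      have := ih (q * x⁻¹) (P.1.mul_mem hq (P.1.inv_mem hx'))
      rw [← mul_assoc t, inv_mul_cancel_right] at this
      exact this.symm hrev
  have := key p (by rwa [hS.closure_inter P.1 P.2]) 1 P.1.one_mem
  rwa [mul_one] at this

variable {H : Subgroup G} {Z : InvSubgraph H (freeCuspedGraph 𝓟 S)} {b : Z.graph.V}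
  {σ : ∀ z : (Z.graph.quotient H).V,
    {l // (Z.graph.quotient H).IsPath ((Z.graph.proj H).onV b) l z}}

/-- Conjugating J by g_i⁻¹ gives infinitely many elements of H preserving the horoball of g_i⁻¹ t P.
So each g_i Z̃ contains a nested part of the horoball of t P, and finitely many such parts share a
level. -/
theorem exists_multiplicity_of_parabolic (hS : IsCompatibleGenSet 𝓟 S)
    (hZ : ∀ (P : 𝓟) (t : G),
      {h : H | (fun v => (h : G) • v) '' horoballVerts P t 0 = horoballVerts P t 0}.Infinite →
      ∃ n, horoballVerts P t n ⊆ Z.verts ∧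
        ∀ e, (freeCuspedGraph 𝓟 S).src e ∈ horoballVerts P t n →
          (freeCuspedGraph 𝓟 S).tgt e ∈ horoballVerts P t n → e ∈ Z.edges)
    {n : ℕ} [NeZero n] {g : Fin n → G} (hg : Function.Injective (fun i => (g i : G ⧸ H)))
    {J : Subgroup G} (hJ : (J : Set G).Infinite) (hJH : ∀ j ∈ J, ∀ i, (g i)⁻¹ * j * g i ∈ H)
    {P : 𝓟} {t : G} (hP : ∀ j ∈ J, t⁻¹ * j * t ∈ P.1) :
    ∃ p : (Z.pullback n).V, ∀ i, ((Z.tau b σ n p i).range : Set H).Infinite := by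
  have hdeep : ∀ i, ∃ k, horoballVerts P ((g i)⁻¹ * t) k ⊆ Z.verts ∧
        ∀ e, (freeCuspedGraph 𝓟 S).src e ∈ horoballVerts P ((g i)⁻¹ * t) k →
          (freeCuspedGraph 𝓟 S).tgt e ∈ horoballVerts P ((g i)⁻¹ * t) k → e ∈ Z.edges := by
    refine fun i => hZ P _ ?_
    have : Infinite J := hJ.to_subtype
    refine (Set.infinite_range_of_injective
      (f := fun j : J => (⟨_, hJH j j.2 i⟩ : H)) ?_).mono ?_
    · intro j j' h
      exact Subtype.ext (mul_left_cancel (mul_right_cancel (congrArg Subtype.val h)))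
    · rintro _ ⟨j, rfl⟩
      refine image_smul_horoballVerts ?_ 0
      have := hP j j.2
      simpa [mul_assoc] using this
  choose k hkV hkE using hdeep
  set K := Finset.univ.sup k
  -- The vertex `horo P t K` has depth K + 1, so it lies on a level of positive depth even if all `k
  -- i` vanish; only such levels have the horizontal edges needed.
  have hK : ∀ i, k i ≤ K + 1 := fun i => (Finset.le_sup (Finset.mem_univ i)).trans (Nat.le_succ _)
  let E : Set (freeCuspedGraph 𝓟 S).E := {e | ∀ i, (g i)⁻¹ • e ∈ Z.edges}
  have hErev : ∀ e ∈ E, (freeCuspedGraph 𝓟 S).rev e ∈ E := fun e he i => by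
    rw [← FreeAction.rev_smul]; exact Z.rev_mem _ (he i)
  have hmem : ∀ {v : CuspedVertex 𝓟}, v ∈ horoballVerts P t (K + 1) → ∀ i,
      (g i)⁻¹ • v ∈ horoballVerts P ((g i)⁻¹ * t) (k i) := fun hv i =>
    horoballVerts_anti (hK i) (smul_mem_horoballVerts hv _)
  have hE : ∀ e, (freeCuspedGraph 𝓟 S).src e ∈ horoballVerts P t (K + 1) →
      (freeCuspedGraph 𝓟 S).tgt e ∈ horoballVerts P t (K + 1) → e ∈ E := by
    intro e h1 h2 i
    refine hkE i _ ?_ ?_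
    · rw [FreeAction.src_smul]; exact hmem h1 i
    · rw [tgt, FreeAction.rev_smul, FreeAction.src_smul]; exact hmem h2 i
  refine Z.exists_multiplicity_of_paths hg (x := horo P t K) (J := J)
    (fun i => hkV i (hmem ⟨1, P.1.one_mem, K + 1, le_rfl, by rw [mul_one]; rfl⟩ i)) hJ hJH ?_
  intro j hj
  have := joined_horoball hS P t K hErev hE (hP j hj)
  rw [show t * (t⁻¹ * j * t) = j * t by group] at this
  exact this

end Cusped

/-! ### Equality of height and multiplicity -/

theorem theoremA6 (δ : ℝ) : ∃ D : ℝ, ∀ (G : Type u) [Group G] (𝓟 : Set (Subgroup G))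
    (H : Subgroup G) (𝓓 : Set (Subgroup H)),
    IsRelativelyHyperbolic 𝓟 → IsFullyQuasiconvex 𝓟 H 𝓓 →
    ∀ A : AmbientGraph G, A.IsAdmissible 𝓟 → A.graph.simple.IsGromovHyperbolic δ →
    ∀ R : ℝ, 0 ≤ R → D < R →
    ∀ (Z : SGraph.InvSubgraph H A.graph) (hZ : A.IsHull H 𝓓 R Z)
      (σ : ∀ z : (Z.graph.quotient H).V, {l //
        (Z.graph.quotient H).IsPath ((Z.graph.proj H).onV ⟨A.base, hZ.base_mem⟩) l z}),
      H.height = Z.multiplicity ⟨A.base, hZ.base_mem⟩ σ := by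
  -- The distance from an axis within which the translates of its vertex γ(0) by powers of the
  -- element must lie (`exists_near_axis`).
  refine ⟨4 * δ + 1, ?_⟩
  intro G _ 𝓟 H 𝓓 hrel _ A hA hX R _ hR Z hZ σ
  refine SGraph.InvSubgraph.height_eq_multiplicity fun n _ g hg hinf => ?_
  set J : Subgroup G := ⨅ i, H.map (MulAut.conj (g i)).toMonoidHom with hJ
  have hJH : ∀ j ∈ J, ∀ i, (g i)⁻¹ * j * g i ∈ H := by
    intro j hj i
    obtain ⟨h, hh, rfl⟩ := Subgroup.mem_iInf.1 hj i
    simpa [mul_assoc] using hh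
  have hyp : (∀ (x : A.graph.V) (n : ℕ), {y | A.graph.simple.dist x y ≤ n}.Finite) → ∀ f ∈ J,
      (A.graph.simple.dist A.base (f • A.base) : ℝ) + 3 * δ <
      A.graph.simple.dist A.base ((f * f) • A.base) →
      ∃ p : (Z.pullback n).V, ∀ i, ((Z.tau ⟨A.base, hZ.base_mem⟩ σ n p i).range : Set H).Infinite :=
    fun hfin f hf hlt => AmbientGraph.exists_multiplicity_of_hyperbolic hX hfin hR
      (fun γ h h' => (hZ.geodesic_edges γ h h').2) hg (hJH f hf) hlt
  cases hA with
  | cocompact _ h𝓟 hconn hV hE hno =>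
    have : Finite (Quotient (MulAction.orbitRel G A.graph.V)) := hV
    have : Finite (A.graph.quotient G).E := hE
    have hfin := hX.1.finite_setOf_dist_le (SGraph.finite_setOf_adj (X := A.graph) (K := G))
    obtain ⟨f, hf, hlt⟩ := hX.exists_of_cocompact (SGraph.dist_smul (K := G))
      SGraph.FreeAction.free hfin
      (Set.finite_range (Quotient.out : (A.graph.quotient G).V → A.graph.V))
      (fun x => ⟨_, ⟨(A.graph.proj G).onV x, rfl⟩, by
        obtain ⟨k, hk⟩ := (A.graph.proj_onV_eq G).1
          (Quotient.out_eq ((A.graph.proj G).onV x)).symm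
        exact ⟨k, hk.symm⟩⟩) hinf A.base
    exact hyp hfin f hf hlt
  | cusped hne S hS =>
    have hX' : (cuspedGraph 𝓟 S).IsGromovHyperbolic δ := by
      rw [← simple_freeCuspedGraph (𝓟 := 𝓟) (S := S)]
      exact hX
    by_cases hlox : ∃ f ∈ J, ((AmbientGraph.cusped 𝓟 S).graph.simple.dist
      (AmbientGraph.cusped 𝓟 S).base (f • (AmbientGraph.cusped 𝓟 S).base) : ℝ) + 3 * δ <
      (AmbientGraph.cusped 𝓟 S).graph.simple.dist (AmbientGraph.cusped 𝓟 S).base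
        ((f * f) • (AmbientGraph.cusped 𝓟 S).base)
    · obtain ⟨f, hf, hlt⟩ := hlox
      refine hyp (hX.1.finite_setOf_dist_le ?_) f hf hlt
      change ∀ x, {y | (freeCuspedGraph 𝓟 S).simple.Adj x y}.Finite
      rw [simple_freeCuspedGraph]
      exact finite_setOf_cuspedGraph_adj hrel.1 hS.finite
    -- No element of J has an axis by the criterion, so J preserves a horoball.
    · push Not at hlox
      have hpar : ∀ f ∈ J, ((freeCuspedGraph 𝓟 S).simple.dist (CuspedVertex.base 1)
          ((f * f) • (CuspedVertex.base 1 : CuspedVertex 𝓟)) : ℝ) ≤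
          (freeCuspedGraph 𝓟 S).simple.dist (CuspedVertex.base 1)
            (f • (CuspedVertex.base 1 : CuspedVertex 𝓟)) + 3 * δ := hlox
      rw [simple_freeCuspedGraph] at hpar
      obtain ⟨P, t, hP⟩ := exists_horoball_of_noHyperbolic hrel.1 hS.finite hX' hinf hpar
      exact exists_multiplicity_of_parabolic hS
        (fun P t h => hZ.horoball _ ⟨P, t, rfl⟩ h) hg hinf hJH hP
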